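/- Let $n\in\mathbb N$, $T>0$, let $H_0,H_1\in\mathfrak{su}(n)$ be traceless skew-Hermitian matrices and let $\rho_0,\theta$ be Hermitian $n\times n$ matrices with simple eigenvalues. Put $\mathcal H=L^2([0,T],\mathbb R)$ with its standard inner product, and for $u\in\mathcal H$ let $\mathrm{End}_{\rho_0}(u)=\rho(T)$, where $\rho$ is the (Carathéodory) solution of $\dot\rho(t)=[H_0+u(t)H_1,\rho(t)]$, $\rho(0)=\rho_0$. Let $\mathcal O(\rho_0)=\{U\rho_0U^\dagger: U\in SU(n)\}$, with tangent spaces $T_\rho\mathcal O(\rho_0)=\{[\rho,\Omega]:\Omega\in\mathfrak{su}(n)\}$ and dimension $N$; let $J(\rho)=\operatorname{Re}\operatorname{tr}(\rho\theta)$ on $\mathcal O(\rho_0)$ and $\mathcal J=J\circ\mathrm{End}_{\rho_0}$ on $\mathcal H$. Assume that every control is regular: for all $u\in\mathcal H$ the rank of $d\,\mathrm{End}_{\rho_0}(u)$ equals $N$. Let $\rho_i$ be a critical point of $J$ on $\mathcal O(\rho_0)$ and $\mathcal H_i=\{u\in\mathcal H:\mathrm{End}_{\rho_0}(u)=\rho_i\}$.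 Then there is an integer $0\le N_1^i\le N$, depending on $\rho_i$ only, such that for every connected component $\mathcal C$ of $\mathcal H_i$ and every $u_c\in\mathcal C$ the following holds. The Morse index of $\mathcal J$ at $u_c$ (the maximal dimension of a subspace of $\mathcal H$ on which the second derivative of $\mathcal J$ at $u_c$ is negative definite) is $N_1^i$, and there are an orthogonal decomposition $\mathcal H=\mathcal P_1\oplus\mathcal P_2\oplus\mathcal K$, an open neighbourhood $U$ of $u_c$ in $\mathcal H$ and a smooth chart $\phi$, i.e. a smooth diffeomorphism from $U$ onto an open subset $\phi(U)$ of $\mathcal H=\mathcal P_1\oplus\mathcal P_2\oplus\mathcal K$, such that (i) $\dim\mathcal P_1=N_1^i$ and $\dim\mathcal P_2=N-N_1^i$; (ii) $\phi(u_c)=0$ and $\phi(U\cap\mathcal C)=\{(v_1,v_2,w)\in\mathcal P_1\times\mathcal P_2\times\mathcal K:\ v_1=v_2=0\}$; (iii) $\mathcal J\circ\phi^{-1}(v_1,v_2,w)=\mathcal J(u_c)-\|v_1\|_{\mathcal H}^2+\|v_2\|_{\mathcal H}^2$ for all $(v_1,v_2,w)\in\phi(U)$. -/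

import Mathlib

open MeasureTheory
open scoped Matrix ContDiff

namespace QuantumControl

noncomputable section

/-- The space `L²([0,T], ℝ)` of admissible controls, with its standard inner product. -/
abbrev Control (T : ℝ) : Type := Lp ℝ 2 ((volume : Measure ℝ).restrict (Set.Icc 0 T))

/-- The real vector space of traceless skew-Hermitian `n × n` matrices. -/
def su (n : ℕ) : Submodule ℝ (Matrix (Fin n) (Fin n) ℂ) where
  carrier := {A | Aᴴ = -A ∧ A.trace = 0}
  add_mem' := by
    rintro A B ⟨hA, hA'⟩ ⟨hB, hB'⟩
    refine ⟨?_, ?_⟩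
    · rw [Matrix.conjTranspose_add, hA, hB, neg_add]
    · rw [Matrix.trace_add, hA', hB', add_zero]
  zero_mem' := by simp
  smul_mem' := by
    rintro c A ⟨hA, hA'⟩
    refine ⟨?_, ?_⟩
    · rw [Matrix.conjTranspose_smul, hA, star_trivial, smul_neg]
    · rw [Matrix.trace_smul, hA', smul_zero]

/-- The unitary orbit `{U ρ₀ U† : U ∈ SU(n)}` of a matrix `ρ₀`. -/
def orbit {n : ℕ} (ρ₀ : Matrix (Fin n) (Fin n) ℂ) : Set (Matrix (Fin n) (Fin n) ℂ) :=
  {ρ | ∃ U ∈ Matrix.specialUnitaryGroup (Fin n) ℂ, ρ = U * ρ₀ * Uᴴ}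

/-- The real-linear map `Ω ↦ [ρ, Ω] = ρ Ω - Ω ρ`. -/
def adMap {n : ℕ} (ρ : Matrix (Fin n) (Fin n) ℂ) :
    Matrix (Fin n) (Fin n) ℂ →ₗ[ℝ] Matrix (Fin n) (Fin n) ℂ where
  toFun Ω := ρ * Ω - Ω * ρ
  map_add' A B := by rw [mul_add, add_mul]; abel
  map_smul' c A := by simp [smul_sub]

/-- The tangent space `[ρ, 𝔰𝔲(n)]` at `ρ` of the unitary orbit through `ρ`. -/
def tangentSpace {n : ℕ} (ρ : Matrix (Fin n) (Fin n) ℂ) :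
    Submodule ℝ (Matrix (Fin n) (Fin n) ℂ) :=
  (su n).map (adMap ρ)

/-- The dimension `N` of the unitary orbit of `ρ₀`. -/
def orbitDim {n : ℕ} (ρ₀ : Matrix (Fin n) (Fin n) ℂ) : ℕ :=
  Module.finrank ℝ (tangentSpace ρ₀)

/-- The kinematic cost `J(ρ) = Re tr (ρ θ)`. -/
def kinematicCost {n : ℕ} (θ ρ : Matrix (Fin n) (Fin n) ℂ) : ℝ :=
  ((ρ * θ).trace).re

/-- `ρ` is a critical point of the restriction of `J` to the unitary orbit of `ρ₀`: it lies on the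
orbit and the differential of `J` at `ρ` vanishes on the tangent space of the orbit at `ρ`. -/
def IsKinematicCritical {n : ℕ} (θ ρ₀ ρ : Matrix (Fin n) (Fin n) ℂ) : Prop :=
  ρ ∈ orbit ρ₀ ∧ ∀ η ∈ tangentSpace ρ, fderiv ℝ (kinematicCost θ) ρ η = 0

/-- `ρ` is the trajectory on `[0,T]` (a Carathéodory solution, in integrated form, entry by entry)
of `ρ' = [H₀ + u(t) H₁, ρ]`, `ρ(0) = ρ₀`. -/
def IsTrajectory {n : ℕ} (T : ℝ) (H₀ H₁ ρ₀ : Matrix (Fin n) (Fin n) ℂ) (u : Control T)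
    (ρ : ℝ → Matrix (Fin n) (Fin n) ℂ) : Prop :=
  ContinuousOn ρ (Set.Icc 0 T) ∧
    ∀ t ∈ Set.Icc 0 T, ∀ j k : Fin n,
      ρ t j k = ρ₀ j k +
        ∫ s in (0 : ℝ)..t, ((H₀ + u s • H₁) * ρ s - ρ s * (H₀ + u s • H₁)) j k

/-- The end-point map `u ↦ ρ(T)`, where `ρ` is the (unique) trajectory driven by `u`. -/
def endPoint {n : ℕ} (T : ℝ) (H₀ H₁ ρ₀ : Matrix (Fin n) (Fin n) ℂ) (u : Control T) :
    Matrix (Fin n) (Fin n) ℂ :=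
  Classical.epsilon fun σ => ∃ ρ, IsTrajectory T H₀ H₁ ρ₀ u ρ ∧ ρ T = σ

/-- The cost `𝒥(u) = Re tr (End(u) θ)` on the space of controls. -/
def cost {n : ℕ} (T : ℝ) (H₀ H₁ ρ₀ θ : Matrix (Fin n) (Fin n) ℂ) (u : Control T) : ℝ :=
  ((endPoint T H₀ H₁ ρ₀ u * θ).trace).re

/-- `u` is a regular control: the rank of the differential of the end-point map at `u` is the
dimension of the unitary orbit. -/
def IsRegularControl {n : ℕ} (T : ℝ) (H₀ H₁ ρ₀ : Matrix (Fin n) (Fin n) ℂ)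
    (u : Control T) : Prop :=
  Module.finrank ℝ (LinearMap.range (fderiv ℝ (endPoint T H₀ H₁ ρ₀) u).toLinearMap) = orbitDim ρ₀

/-- The set of controls that steer `ρ₀` to `σ` in time `T`. -/
def fiber {n : ℕ} (T : ℝ) (H₀ H₁ ρ₀ σ : Matrix (Fin n) (Fin n) ℂ) : Set (Control T) :=
  {u | endPoint T H₀ H₁ ρ₀ u = σ}

/-- The Morse index of `f` at `x`: the supremum of the dimensions of the finite-dimensional
subspaces on which the second derivative of `f` at `x` is negative definite. -/
def morseIndex {E : Type*} [NormedAddCommGroup E] [NormedSpace ℝ E] (f : E → ℝ) (x : E) : ℕ∞ :=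
  ⨆ (W : Submodule ℝ E) (_ : FiniteDimensional ℝ W)
    (_ : ∀ v ∈ W, v ≠ 0 → fderiv ℝ (fderiv ℝ f) x v v < 0), (Module.finrank ℝ W : ℕ∞)

end

end QuantumControl

/-!
The trajectory is `ρ(T) = U ρ₀ U†`, where the unitary propagator `U` is the value at time `T` of
`(1 - K)⁻¹ 1` for a Volterra operator `K` that is affine in the control. Some power of `K` is a
contraction, so `1 - K` is invertible and the end-point map `End` is smooth. Differentiating the
conjugation gives `dEnd v = ⁅ω v, End⁆` with `ω = dU · U⁻¹` skew-Hermitian: the image of `dEnd` lies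
in the tangent space of the orbit, so its rank is at most `N` at every control. At a regular
control the rank is maximal, hence locally constant, and the constant-rank theorem straightens the
fibre of `End`.

At a critical point `ρ` of `J` the matrix `θ` commutes with `ρ`. So the second derivative of `𝒥` is
`Re tr (⁅ω v, ⁅ω v, ρ⁆⁆ θ)`, the pull-back along `dEnd` of a quadratic form on the tangent
space at `ρ`. This form is nondegenerate: a tangent vector in its kernel commutes with `θ`, which is
simple, hence also with `ρ`, and `⁅A, ρ⁆` commutes with `ρ` only if it vanishes. Its negative index
depends on `ρ` only, and is the Morse index. The normal form follows from the Morse lemma applied in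
the directions transversal to the fibre; there, the weighted mean `X y` of the Hessians along the
segment from `0` to `y` satisfies `X y = (P y)⋆ (X 0) (P y)` with `P` smooth, and `y ↦ P y y` is the
chart.
-/

namespace QuantumControl

noncomputable section

section LinearFlow

variable {W : Type*} [NormedAddCommGroup W] [NormedSpace ℝ W] {T : ℝ}

lemma sq_integral_mul_le {α : Type*} [MeasurableSpace α] {μ : Measure α} {a b : α → ℝ}
    (ha : MemLp a 2 μ) (hb : MemLp b 2 μ) (ha₀ : 0 ≤ a) (hb₀ : 0 ≤ b) :
    (∫ s, a s * b s ∂μ) ^ 2 ≤ (∫ s, a s ^ 2 ∂μ) * ∫ s, b s ^ 2 ∂μ := by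
  have hölder := integral_mul_le_Lp_mul_Lq_of_nonneg (μ := μ) Real.HolderConjugate.two_two
    (.of_forall ha₀) (.of_forall hb₀) (by simpa using ha) (by simpa using hb)
  have hab : 0 ≤ ∫ s, a s * b s ∂μ := integral_nonneg fun s => mul_nonneg (ha₀ s) (hb₀ s)
  simp only [Real.rpow_two, ← Real.sqrt_eq_rpow] at hölder
  calc _ ≤ (√(∫ s, a s ^ 2 ∂μ) * √(∫ s, b s ^ 2 ∂μ)) ^ 2 := by gcongr
    _ = _ := by
      rw [mul_pow, Real.sq_sqrt (integral_nonneg fun s => sq_nonneg _),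
        Real.sq_sqrt (integral_nonneg fun s => sq_nonneg _)]

lemma Control.integrableOn (u : Control T) : IntegrableOn u (Set.Icc 0 T) :=
  (Lp.memLp u).integrable one_le_two

lemma Control.integral_sq_le (u : Control T) {t : ℝ} (ht : t ∈ Set.Icc 0 T) :
    ∫ s in (0 : ℝ)..t, u s ^ 2 ≤ ‖u‖ ^ 2 := by
  have hnorm : ‖u‖ ^ 2 = ∫ s in Set.Icc 0 T, u s ^ 2 := by
    rw [← real_inner_self_eq_norm_sq, L2.inner_def]
    simp only [inner_self_eq_norm_sq_to_K, Real.ringHom_apply, Real.norm_eq_abs, sq_abs]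
  have hu : IntegrableOn (fun s => u s ^ 2) (Set.Icc 0 T) := (Lp.memLp u).integrable_sq
  rw [hnorm, intervalIntegral.integral_of_le ht.1, ← integral_Icc_eq_integral_Ioc]
  exact setIntegral_mono_set hu (.of_forall fun s => sq_nonneg _)
    (Set.Icc_subset_Icc_right ht.2).eventuallyLE

lemma integrableOn_control_smul (h : 0 ≤ T) (u : Control T) (M : W →L[ℝ] W)
    (x : C(Set.Icc (0 : ℝ) T, W)) :
    IntegrableOn (fun s => u s • M (Set.IccExtend h x s)) (Set.Icc 0 T) :=
  u.integrableOn.smul_continuousOn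
    (M.continuous.comp x.continuous.Icc_extend').continuousOn isCompact_Icc

lemma intervalIntegrable_control_smul (h : 0 ≤ T) (u : Control T) (M : W →L[ℝ] W)
    (x : C(Set.Icc (0 : ℝ) T, W)) (t : Set.Icc (0 : ℝ) T) :
    IntervalIntegrable (fun s => u s • M (Set.IccExtend h x s)) volume 0 t := by
  rw [intervalIntegrable_iff_integrableOn_Icc_of_le t.2.1]
  exact (integrableOn_control_smul h u M x).mono_set (Set.Icc_subset_Icc_right t.2.2)

lemma intervalIntegral_congr_ae_Icc {f g : ℝ → W} (t : Set.Icc (0 : ℝ) T)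
    (hfg : ∀ᵐ s ∂(volume : Measure ℝ).restrict (Set.Icc 0 T), f s = g s) :
    ∫ s in (0 : ℝ)..t, f s = ∫ s in (0 : ℝ)..t, g s := by
  refine intervalIntegral.integral_congr_ae ?_
  filter_upwards [(ae_restrict_iff' measurableSet_Icc).1 hfg] with s hs hst
  rw [Set.uIoc_of_le t.2.1] at hst
  exact hs ⟨hst.1.le, hst.2.trans t.2.2⟩

/-- The Volterra operator `x ↦ (t ↦ ∫₀ᵗ u(s) M x(s) ds)` on continuous paths, the integral operator
of the linear equation `x' = u M x`. -/
def volterraFun (h : 0 ≤ T) (M : W →L[ℝ] W) (u : Control T) (x : C(Set.Icc (0 : ℝ) T, W)) :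
    C(Set.Icc (0 : ℝ) T, W) where
  toFun t := ∫ s in (0 : ℝ)..t, u s • M (Set.IccExtend h x s)
  continuous_toFun := by
    have hcont := intervalIntegral.continuousOn_primitive_interval (a := 0) (b := T)
      (f := fun s => u s • M (Set.IccExtend h x s)) (μ := volume) (by
        rw [Set.uIcc_of_le h]; exact integrableOn_control_smul h u M x)
    rwa [Set.uIcc_of_le h, continuousOn_iff_continuous_domRestrict] at hcont

lemma volterraFun_apply (h : 0 ≤ T) (M : W →L[ℝ] W) (u : Control T)
    (x : C(Set.Icc (0 : ℝ) T, W)) (t : Set.Icc (0 : ℝ) T) :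
    volterraFun h M u x t = ∫ s in (0 : ℝ)..t, u s • M (Set.IccExtend h x s) := rfl

lemma volterraFun_add_control (h : 0 ≤ T) (M : W →L[ℝ] W) (u v : Control T)
    (x : C(Set.Icc (0 : ℝ) T, W)) :
    volterraFun h M (u + v) x = volterraFun h M u x + volterraFun h M v x := by
  ext t
  simp only [volterraFun_apply, ContinuousMap.add_apply]
  rw [← intervalIntegral.integral_add (intervalIntegrable_control_smul h u M x t)
    (intervalIntegrable_control_smul h v M x t)]
  refine intervalIntegral_congr_ae_Icc t ?_
  filter_upwards [Lp.coeFn_add u v] with s hs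
  rw [hs, Pi.add_apply, add_smul]

lemma volterraFun_smul_control (h : 0 ≤ T) (M : W →L[ℝ] W) (c : ℝ) (u : Control T)
    (x : C(Set.Icc (0 : ℝ) T, W)) : volterraFun h M (c • u) x = c • volterraFun h M u x := by
  ext t
  simp only [volterraFun_apply, ContinuousMap.smul_apply]
  rw [← intervalIntegral.integral_smul]
  refine intervalIntegral_congr_ae_Icc t ?_
  filter_upwards [Lp.coeFn_smul c u] with s hs
  rw [hs, Pi.smul_apply, smul_assoc]

lemma volterraFun_add (h : 0 ≤ T) (M : W →L[ℝ] W) (u : Control T)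
    (x y : C(Set.Icc (0 : ℝ) T, W)) :
    volterraFun h M u (x + y) = volterraFun h M u x + volterraFun h M u y := by
  ext t
  simp only [volterraFun_apply, ContinuousMap.add_apply]
  rw [← intervalIntegral.integral_add (intervalIntegrable_control_smul h u M x t)
    (intervalIntegrable_control_smul h u M y t)]
  simp only [Set.IccExtend_apply, ContinuousMap.add_apply, map_add, smul_add]

lemma volterraFun_smul (h : 0 ≤ T) (M : W →L[ℝ] W) (c : ℝ) (u : Control T)
    (x : C(Set.Icc (0 : ℝ) T, W)) : volterraFun h M u (c • x) = c • volterraFun h M u x := by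
  ext t
  simp only [volterraFun_apply, ContinuousMap.smul_apply]
  rw [← intervalIntegral.integral_smul]
  simp only [Set.IccExtend_apply, ContinuousMap.smul_apply, map_smul, smul_comm c]

lemma norm_volterraFun_apply_le (h : 0 ≤ T) (M : W →L[ℝ] W) (u : Control T)
    (x : C(Set.Icc (0 : ℝ) T, W)) (t : Set.Icc (0 : ℝ) T) :
    ‖volterraFun h M u x t‖ ≤ ‖M‖ * ∫ s in (0 : ℝ)..t, ‖u s‖ * ‖Set.IccExtend h x s‖ := by
  rw [← intervalIntegral.integral_const_mul]
  refine intervalIntegral.norm_integral_le_of_norm_le t.2.1 (.of_forall fun s _ => ?_) ?_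
  · rw [norm_smul, mul_left_comm]
    gcongr
    exact M.le_opNorm _
  · rw [intervalIntegrable_iff_integrableOn_Icc_of_le t.2.1]
    exact ((IntegrableOn.mul_continuousOn u.integrableOn.norm
      x.continuous.Icc_extend'.norm.continuousOn isCompact_Icc).mono_set
      (Set.Icc_subset_Icc_right t.2.2)).const_mul _

lemma sq_norm_volterraFun_apply_le (h : 0 ≤ T) (M : W →L[ℝ] W) (u : Control T)
    (x : C(Set.Icc (0 : ℝ) T, W)) (t : Set.Icc (0 : ℝ) T) :
    ‖volterraFun h M u x t‖ ^ 2 ≤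
      (‖M‖ * ‖u‖) ^ 2 * ∫ s in (0 : ℝ)..t, ‖Set.IccExtend h x s‖ ^ 2 := by
  have hu : MemLp (fun s => ‖u s‖) 2 ((volume : Measure ℝ).restrict (Set.Ioc 0 t)) :=
    (Lp.memLp u).norm.mono_measure (Measure.restrict_mono
      (Set.Ioc_subset_Icc_self.trans (Set.Icc_subset_Icc_right t.2.2)) le_rfl)
  have hx : MemLp (fun s => ‖Set.IccExtend h x s‖) 2
      ((volume : Measure ℝ).restrict (Set.Ioc 0 t)) := by
    refine MemLp.of_bound x.continuous.Icc_extend'.norm.aestronglyMeasurable ‖x‖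
      (.of_forall fun s => ?_)
    rw [norm_norm]
    exact x.norm_coe_le_norm _
  have cauchySchwarz := sq_integral_mul_le hu hx (fun _ => norm_nonneg _) (fun _ => norm_nonneg _)
  have hle := norm_volterraFun_apply_le h M u x t
  have hu_sq := u.integral_sq_le t.2
  simp only [intervalIntegral.integral_of_le t.2.1, Real.norm_eq_abs, sq_abs] at *
  calc _ ≤ (‖M‖ * ∫ s in Set.Ioc 0 (t : ℝ), |u s| * ‖Set.IccExtend h x s‖) ^ 2 := by gcongr
    _ ≤ ‖M‖ ^ 2 * ((∫ s in Set.Ioc 0 (t : ℝ), u s ^ 2) *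
          ∫ s in Set.Ioc 0 (t : ℝ), ‖Set.IccExtend h x s‖ ^ 2) := by
        rw [mul_pow]; gcongr
    _ ≤ ‖M‖ ^ 2 * (‖u‖ ^ 2 * ∫ s in Set.Ioc 0 (t : ℝ), ‖Set.IccExtend h x s‖ ^ 2) := by
        gcongr
    _ = _ := by ring

lemma integral_sq_norm_IccExtend_le {F : Type*} [NormedAddCommGroup F] (h : 0 ≤ T)
    (x : C(Set.Icc (0 : ℝ) T, F)) (t : Set.Icc (0 : ℝ) T) :
    ∫ s in (0 : ℝ)..t, ‖Set.IccExtend h x s‖ ^ 2 ≤ T * ‖x‖ ^ 2 := by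
  calc ∫ s in (0 : ℝ)..t, ‖Set.IccExtend h x s‖ ^ 2 ≤ ∫ s in (0 : ℝ)..t, ‖x‖ ^ 2 := by
        refine intervalIntegral.integral_mono_on t.2.1 ?_ (by simp) fun s _ => ?_
        · exact (x.continuous.Icc_extend'.norm.pow 2).intervalIntegrable _ _
        · gcongr
          exact x.norm_coe_le_norm _
    _ = t * ‖x‖ ^ 2 := by simp only [intervalIntegral.integral_const, sub_zero, smul_eq_mul]
    _ ≤ T * ‖x‖ ^ 2 := by
        gcongr
        exact t.2.2

lemma norm_volterraFun_le (h : 0 ≤ T) (M : W →L[ℝ] W) (u : Control T)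
    (x : C(Set.Icc (0 : ℝ) T, W)) :
    ‖volterraFun h M u x‖ ≤ ‖M‖ * √T * ‖u‖ * ‖x‖ := by
  rw [ContinuousMap.norm_le _ (by positivity)]
  refine fun t => (abs_le_of_sq_le_sq' ?_ (by positivity)).2
  calc _ ≤ (‖M‖ * ‖u‖) ^ 2 * ∫ s in (0 : ℝ)..t, ‖Set.IccExtend h x s‖ ^ 2 :=
        sq_norm_volterraFun_apply_le h M u x t
    _ ≤ (‖M‖ * ‖u‖) ^ 2 * (T * ‖x‖ ^ 2) := by
        gcongr
        exact integral_sq_norm_IccExtend_le h x t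
    _ = _ := by
        simp only [mul_pow, Real.sq_sqrt h]
        ring

/-- The Volterra operator as a bounded operator on paths that depends linearly on the control. -/
def volterra (h : 0 ≤ T) (M : W →L[ℝ] W) :
    Control T →L[ℝ] C(Set.Icc (0 : ℝ) T, W) →L[ℝ] C(Set.Icc (0 : ℝ) T, W) :=
  LinearMap.mkContinuous₂
    (LinearMap.mk₂ ℝ (volterraFun h M) (volterraFun_add_control h M) (volterraFun_smul_control h M)
      (volterraFun_add h M) fun c u => volterraFun_smul h M c u)
    (‖M‖ * √T) (norm_volterraFun_le h M)

lemma volterra_apply (h : 0 ≤ T) (M : W →L[ℝ] W) (u : Control T)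
    (x : C(Set.Icc (0 : ℝ) T, W)) : volterra h M u x = volterraFun h M u x := rfl

lemma sq_norm_pow_apply_le_of_volterra_bound (h : 0 ≤ T)
    {V : C(Set.Icc (0 : ℝ) T, W) →L[ℝ] C(Set.Icc (0 : ℝ) T, W)} {c : ℝ} (hc : 0 ≤ c)
    (hV : ∀ x t, ‖V x t‖ ^ 2 ≤ c * ∫ s in (0 : ℝ)..t, ‖Set.IccExtend h x s‖ ^ 2) (n : ℕ)
    (x : C(Set.Icc (0 : ℝ) T, W)) (t : Set.Icc (0 : ℝ) T) :
    ‖(V ^ n) x t‖ ^ 2 ≤ (c * t) ^ n / n.factorial * ‖x‖ ^ 2 := by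
  induction n generalizing t with
  | zero =>
    simp only [pow_zero, Nat.factorial_zero, Nat.cast_one, div_one, one_mul]
    gcongr
    exact x.norm_coe_le_norm _
  | succ n ih =>
    have hint : ∫ s in (0 : ℝ)..t, ‖Set.IccExtend h ((V ^ n) x) s‖ ^ 2 ≤
        ∫ s in (0 : ℝ)..t, (c ^ n / n.factorial * ‖x‖ ^ 2) * s ^ n := by
      refine intervalIntegral.integral_mono_on t.2.1 ?_ ?_ fun s hs => ?_
      · exact (((V ^ n) x).continuous.Icc_extend'.norm.pow 2).intervalIntegrable _ _
      · exact (by fun_prop : Continuous _).intervalIntegrable _ _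
      · have hs' : s ∈ Set.Icc 0 T := ⟨hs.1, hs.2.trans t.2.2⟩
        rw [Set.IccExtend_of_mem h _ hs']
        exact (ih ⟨s, hs'⟩).trans_eq (by ring)
    rw [intervalIntegral.integral_const_mul, integral_pow] at hint
    rw [pow_succ' V n]
    calc _ ≤ c * ∫ s in (0 : ℝ)..t, ‖Set.IccExtend h ((V ^ n) x) s‖ ^ 2 := hV ((V ^ n) x) t
      _ ≤ c * ((c ^ n / n.factorial * ‖x‖ ^ 2) *
            (((t : ℝ) ^ (n + 1) - 0 ^ (n + 1)) / (n + 1))) := by gcongr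
      _ = _ := by
        rw [Nat.factorial_succ]
        push_cast
        field_simp
        ring

lemma norm_pow_le_of_volterra_bound (h : 0 ≤ T)
    {V : C(Set.Icc (0 : ℝ) T, W) →L[ℝ] C(Set.Icc (0 : ℝ) T, W)} {c : ℝ} (hc : 0 ≤ c)
    (hV : ∀ x t, ‖V x t‖ ^ 2 ≤ c * ∫ s in (0 : ℝ)..t, ‖Set.IccExtend h x s‖ ^ 2) (n : ℕ) :
    ‖V ^ n‖ ≤ √((c * T) ^ n / n.factorial) := by
  refine ContinuousLinearMap.opNorm_le_bound _ (by positivity) fun x => ?_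
  rw [ContinuousMap.norm_le _ (by positivity)]
  refine fun t => (abs_le_of_sq_le_sq' ?_ (by positivity)).2
  rw [mul_pow, Real.sq_sqrt (by positivity)]
  refine (sq_norm_pow_apply_le_of_volterra_bound h hc hV n x t).trans ?_
  have ⟨ht₀, ht⟩ := t.2
  gcongr

lemma isUnit_one_sub_of_volterra_bound [CompleteSpace W] (h : 0 ≤ T)
    {V : C(Set.Icc (0 : ℝ) T, W) →L[ℝ] C(Set.Icc (0 : ℝ) T, W)} {c : ℝ} (hc : 0 ≤ c)
    (hV : ∀ x t, ‖V x t‖ ^ 2 ≤ c * ∫ s in (0 : ℝ)..t, ‖Set.IccExtend h x s‖ ^ 2) :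
    IsUnit (1 - V) := by
  have hlim : Filter.Tendsto (fun n : ℕ => √((c * T) ^ n / n.factorial)) Filter.atTop (nhds 0) := by
    simpa using (FloorSemiring.tendsto_pow_div_factorial_atTop (c * T)).sqrt
  obtain ⟨n, hn⟩ := (hlim.eventually (gt_mem_nhds one_pos)).exists
  have hunit : IsUnit (1 - V ^ n) := isUnit_one_sub_of_norm_lt_one
    (R := C(Set.Icc (0 : ℝ) T, W) →L[ℝ] C(Set.Icc (0 : ℝ) T, W))
    ((norm_pow_le_of_volterra_bound h hc hV n).trans_lt hn)
  have hcomm : Commute (1 - V) (∑ i ∈ Finset.range n, V ^ i) :=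
    .sum_right _ _ _ fun i _ => (Commute.one_left _).sub_left ((Commute.refl V).pow_right i)
  rw [← mul_neg_geom_sum V n, hcomm.isUnit_mul_iff] at hunit
  exact hunit.1

/-- The constant control `1`, which lets the drift of a control system be treated like a
controlled term. -/
def unitControl (T : ℝ) : Control T :=
  Lp.const 2 ((volume : Measure ℝ).restrict (Set.Icc 0 T)) (1 : ℝ)

lemma intervalIntegrable_drift_add_control (h : 0 ≤ T) (M₀ M₁ : W →L[ℝ] W) (u : Control T)
    (x : C(Set.Icc (0 : ℝ) T, W)) (t : Set.Icc (0 : ℝ) T) :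
    IntervalIntegrable (fun s => M₀ (Set.IccExtend h x s) + u s • M₁ (Set.IccExtend h x s))
      volume 0 t :=
  ((M₀.continuous.comp x.continuous.Icc_extend').intervalIntegrable _ _).add
    (intervalIntegrable_control_smul h u M₁ x t)

/-- The integral operator `x ↦ (t ↦ ∫₀ᵗ (M₀ + u(s) M₁) x(s) ds)` of the linear equation
`x' = (M₀ + u M₁) x`. -/
def picard (h : 0 ≤ T) (M₀ M₁ : W →L[ℝ] W) (u : Control T) :
    C(Set.Icc (0 : ℝ) T, W) →L[ℝ] C(Set.Icc (0 : ℝ) T, W) :=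
  volterra h M₀ (unitControl T) + volterra h M₁ u

lemma picard_apply (h : 0 ≤ T) (M₀ M₁ : W →L[ℝ] W) (u : Control T)
    (x : C(Set.Icc (0 : ℝ) T, W)) (t : Set.Icc (0 : ℝ) T) :
    picard h M₀ M₁ u x t = ∫ s in (0 : ℝ)..t,
      (M₀ (Set.IccExtend h x s) + u s • M₁ (Set.IccExtend h x s)) := by
  simp only [picard, add_apply, ContinuousMap.add_apply, volterra_apply, volterraFun_apply]
  rw [← intervalIntegral.integral_add (intervalIntegrable_control_smul h _ _ x t)
    (intervalIntegrable_control_smul h _ _ x t)]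
  refine intervalIntegral_congr_ae_Icc t ?_
  filter_upwards [Lp.coeFn_const 2 ((volume : Measure ℝ).restrict (Set.Icc 0 T)) (1 : ℝ)]
    with s hs
  rw [unitControl, hs, Function.const_apply, one_smul]

lemma sq_norm_picard_apply_le (h : 0 ≤ T) (M₀ M₁ : W →L[ℝ] W) (u : Control T)
    (x : C(Set.Icc (0 : ℝ) T, W)) (t : Set.Icc (0 : ℝ) T) :
    ‖picard h M₀ M₁ u x t‖ ^ 2 ≤ 2 * ((‖M₀‖ * ‖unitControl T‖) ^ 2 + (‖M₁‖ * ‖u‖) ^ 2) *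
      ∫ s in (0 : ℝ)..t, ‖Set.IccExtend h x s‖ ^ 2 := by
  have hdrift := sq_norm_volterraFun_apply_le h M₀ (unitControl T) x t
  have hcontrol := sq_norm_volterraFun_apply_le h M₁ u x t
  calc ‖picard h M₀ M₁ u x t‖ ^ 2
      ≤ (‖volterraFun h M₀ (unitControl T) x t‖ + ‖volterraFun h M₁ u x t‖) ^ 2 := by
        gcongr
        exact norm_add_le _ _
    _ ≤ 2 * (‖volterraFun h M₀ (unitControl T) x t‖ ^ 2 + ‖volterraFun h M₁ u x t‖ ^ 2) :=
        add_sq_le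
    _ ≤ _ := by linarith

lemma isUnit_one_sub_picard [CompleteSpace W] (h : 0 ≤ T) (M₀ M₁ : W →L[ℝ] W) (u : Control T) :
    IsUnit (1 - picard h M₀ M₁ u) :=
  isUnit_one_sub_of_volterra_bound h (by positivity) (sq_norm_picard_apply_le h M₀ M₁ u)

/-- The solution on `[0,T]` of the linear equation `x' = (M₀ + u M₁) x`, `x(0) = x₀`, obtained by
inverting `1 - picard h M₀ M₁ u`. -/
def linearFlow (h : 0 ≤ T) (M₀ M₁ : W →L[ℝ] W) (x₀ : W) (u : Control T) :
    C(Set.Icc (0 : ℝ) T, W) :=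
  Ring.inverse (1 - picard h M₀ M₁ u) (ContinuousMap.const _ x₀)

variable [CompleteSpace W]

lemma contDiff_linearFlow (h : 0 ≤ T) (M₀ M₁ : W →L[ℝ] W) (x₀ : W) :
    ContDiff ℝ ∞ (linearFlow h M₀ M₁ x₀) := by
  rw [contDiff_iff_contDiffAt]
  intro u
  obtain ⟨U, hU⟩ := isUnit_one_sub_picard h M₀ M₁ u
  have hpicard : ContDiff ℝ ∞ (fun u : Control T => 1 - picard h M₀ M₁ u) := by
    unfold picard
    fun_prop
  have hinv : ContDiffAt ℝ ∞ (fun u : Control T => Ring.inverse (1 - picard h M₀ M₁ u)) u := by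
    refine ContDiffAt.comp (g := Ring.inverse) u ?_ hpicard.contDiffAt
    rw [← hU]
    exact contDiffAt_ringInverse ℝ
      (R := C(Set.Icc (0 : ℝ) T, W) →L[ℝ] C(Set.Icc (0 : ℝ) T, W)) U
  exact hinv.clm_apply contDiffAt_const

lemma eq_linearFlow_iff (h : 0 ≤ T) (M₀ M₁ : W →L[ℝ] W) (x₀ : W) (u : Control T)
    (x : C(Set.Icc (0 : ℝ) T, W)) :
    x = linearFlow h M₀ M₁ x₀ u ↔ ∀ t : Set.Icc (0 : ℝ) T, x t = x₀ + ∫ s in (0 : ℝ)..t,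
      (M₀ (Set.IccExtend h x s) + u s • M₁ (Set.IccExtend h x s)) := by
  obtain ⟨U, hU⟩ := isUnit_one_sub_picard h M₀ M₁ u
  have hsolve : x = linearFlow h M₀ M₁ x₀ u ↔
      (1 - picard h M₀ M₁ u) x = ContinuousMap.const _ x₀ := by
    rw [linearFlow, ← hU, Ring.inverse_unit]
    constructor
    · rintro rfl
      exact DFunLike.congr_fun U.mul_inv _
    · intro hx
      rw [← hx]
      exact (DFunLike.congr_fun U.inv_mul x).symm
  rw [hsolve, ContinuousMap.ext_iff]
  refine forall_congr' fun t => ?_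
  rw [← picard_apply h M₀ M₁ u x t]
  simp [sub_eq_iff_eq_add]

lemma linearFlow_apply (h : 0 ≤ T) (M₀ M₁ : W →L[ℝ] W) (x₀ : W) (u : Control T)
    (t : Set.Icc (0 : ℝ) T) :
    linearFlow h M₀ M₁ x₀ u t = x₀ + ∫ s in (0 : ℝ)..t,
      (M₀ (Set.IccExtend h (linearFlow h M₀ M₁ x₀ u) s) +
        u s • M₁ (Set.IccExtend h (linearFlow h M₀ M₁ x₀ u) s)) :=
  (eq_linearFlow_iff h M₀ M₁ x₀ u _).1 rfl t

lemma contDiff_linearFlow_apply (h : 0 ≤ T) (M₀ M₁ : W →L[ℝ] W) (x₀ : W)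
    (t : Set.Icc (0 : ℝ) T) : ContDiff ℝ ∞ fun u => linearFlow h M₀ M₁ x₀ u t :=
  (ContinuousMap.evalCLM ℝ t : C(Set.Icc (0 : ℝ) T, W) →L[ℝ] W).contDiff.comp
    (contDiff_linearFlow h M₀ M₁ x₀)

lemma exists_hasDerivAt_eq_linearFlow (h : 0 ≤ T) (M₀ M₁ : W →L[ℝ] W) (x₀ : W) {u : Control T}
    {f : ℝ → ℝ} (hf : Continuous f)
    (huf : ∀ᵐ s ∂(volume : Measure ℝ).restrict (Set.Icc 0 T), u s = f s) :
    ∃ y : ℝ → W, y 0 = x₀ ∧ (∀ t ∈ Set.Icc 0 T, HasDerivAt y (M₀ (y t) + f t • M₁ (y t)) t) ∧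
      ∀ t : Set.Icc (0 : ℝ) T, y t = linearFlow h M₀ M₁ x₀ u t := by
  set x := Set.IccExtend h (linearFlow h M₀ M₁ x₀ u) with hx
  have hxc : Continuous x := (linearFlow h M₀ M₁ x₀ u).continuous.Icc_extend'
  have hg : Continuous fun s => M₀ (x s) + f s • M₁ (x s) := by fun_prop
  set y : ℝ → W := fun t => x₀ + ∫ s in (0 : ℝ)..t, (M₀ (x s) + f s • M₁ (x s))
  have hyx : ∀ t : Set.Icc (0 : ℝ) T, y t = linearFlow h M₀ M₁ x₀ u t := by
    intro t
    rw [linearFlow_apply]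
    refine congrArg _ (intervalIntegral_congr_ae_Icc t ?_)
    filter_upwards [huf] with s hs
    rw [hs, hx]
  refine ⟨y, by simp [y], fun t ht => ?_, hyx⟩
  rw [hyx ⟨t, ht⟩, ← Set.IccExtend_of_mem h (linearFlow h M₀ M₁ x₀ u) ht]
  exact (hg.integral_hasStrictDerivAt 0 t).hasDerivAt.const_add x₀

lemma linearFlow_eq_of_hasDerivAt (h : 0 ≤ T) (M₀ M₁ : W →L[ℝ] W) (x₀ : W) {u : Control T}
    {f : ℝ → ℝ} (hf : Continuous f)
    (huf : ∀ᵐ s ∂(volume : Measure ℝ).restrict (Set.Icc 0 T), u s = f s) {y : ℝ → W}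
    (hy₀ : y 0 = x₀) (hy : ∀ t ∈ Set.Icc 0 T, HasDerivAt y (M₀ (y t) + f t • M₁ (y t)) t)
    (t : Set.Icc (0 : ℝ) T) : linearFlow h M₀ M₁ x₀ u t = y t := by
  have hyc : ContinuousOn y (Set.Icc 0 T) := fun t ht => (hy t ht).continuousAt.continuousWithinAt
  suffices hflow : (⟨fun t => y t, continuousOn_iff_continuous_domRestrict.1 hyc⟩ :
      C(Set.Icc (0 : ℝ) T, W)) = linearFlow h M₀ M₁ x₀ u from (DFunLike.congr_fun hflow t).symm
  refine (eq_linearFlow_iff h M₀ M₁ x₀ u _).2 fun t => ?_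
  have hsub : Set.uIcc 0 (t : ℝ) ⊆ Set.Icc 0 T := by
    rw [Set.uIcc_of_le t.2.1]
    exact Set.Icc_subset_Icc_right t.2.2
  have hderiv : ContinuousOn (fun s => M₀ (y s) + f s • M₁ (y s)) (Set.Icc 0 T) := by fun_prop
  have ftc := intervalIntegral.integral_eq_sub_of_hasDerivAt (fun s hs => hy s (hsub hs))
    (hderiv.mono hsub).intervalIntegrable
  rw [hy₀, eq_sub_iff_add_eq'] at ftc
  refine ftc.symm.trans (congrArg _ (intervalIntegral_congr_ae_Icc t ?_))
  filter_upwards [huf, ae_restrict_mem measurableSet_Icc] with s hs hsT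
  rw [hs, Set.IccExtend_of_mem h _ hsT]
  rfl

end LinearFlow

section Commutator

variable {𝔸 : Type*} [NormedRing 𝔸] [NormedAlgebra ℝ 𝔸] {T : ℝ}

/-- The commutator `X ↦ ⁅A, X⁆`, as a bounded operator. -/
def commutatorCLM (A : 𝔸) : 𝔸 →L[ℝ] 𝔸 :=
  ContinuousLinearMap.mul ℝ 𝔸 A - (ContinuousLinearMap.mul ℝ 𝔸).flip A

lemma commutatorCLM_apply (A X : 𝔸) : commutatorCLM A X = ⁅A, X⁆ := rfl

lemma commutatorCLM_add_smul (A B X : 𝔸) (c : ℝ) :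
    commutatorCLM A X + c • commutatorCLM B X = ⁅A + c • B, X⁆ := by
  simp only [commutatorCLM_apply, Ring.lie_def, add_mul, mul_add, smul_sub, smul_mul_assoc,
    mul_smul_comm]
  abel

lemma hasDerivAt_conj_of_linear [StarRing 𝔸] [StarModule ℝ 𝔸] [ContinuousStar 𝔸]
    {y : ℝ → 𝔸} {A : 𝔸} {t : ℝ} (hA : star A = -A) (hy : HasDerivAt y (A * y t) t) (ρ₀ : 𝔸) :
    HasDerivAt (fun t => y t * ρ₀ * star (y t)) ⁅A, y t * ρ₀ * star (y t)⁆ t := by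
  refine ((hy.mul_const ρ₀).mul hy.star).congr_deriv ?_
  rw [Ring.lie_def, star_mul, hA]
  noncomm_ring

variable [CompleteSpace 𝔸]

/-- The value at time `T` of the solution of `ρ' = ⁅H₀ + u H₁, ρ⁆`, `ρ(0) = ρ₀`. -/
def commutatorFlow (h : 0 ≤ T) (H₀ H₁ ρ₀ : 𝔸) (u : Control T) : 𝔸 :=
  linearFlow h (commutatorCLM H₀) (commutatorCLM H₁) ρ₀ u ⟨T, h, le_rfl⟩

/-- The value at time `T` of the solution of the Schrödinger equation `U' = (H₀ + u H₁) U`,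
`U(0) = 1`. -/
def propagator (h : 0 ≤ T) (H₀ H₁ : 𝔸) (u : Control T) : 𝔸 :=
  linearFlow h (ContinuousLinearMap.mul ℝ 𝔸 H₀) (ContinuousLinearMap.mul ℝ 𝔸 H₁) 1 u
    ⟨T, h, le_rfl⟩

lemma contDiff_commutatorFlow (h : 0 ≤ T) (H₀ H₁ ρ₀ : 𝔸) :
    ContDiff ℝ ∞ (commutatorFlow h H₀ H₁ ρ₀) :=
  contDiff_linearFlow_apply h _ _ _ _

lemma contDiff_propagator (h : 0 ≤ T) (H₀ H₁ : 𝔸) : ContDiff ℝ ∞ (propagator h H₀ H₁) :=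
  contDiff_linearFlow_apply h _ _ _ _

lemma commutatorFlow_one (h : 0 ≤ T) (H₀ H₁ : 𝔸) (u : Control T) :
    commutatorFlow h H₀ H₁ 1 u = 1 := by
  have hconst : ContinuousMap.const _ 1 =
      linearFlow h (commutatorCLM H₀) (commutatorCLM H₁) 1 u := by
    rw [eq_linearFlow_iff]
    simp [Set.IccExtend_apply, commutatorCLM_apply, Ring.lie_def]
  rw [commutatorFlow, ← hconst, ContinuousMap.const_apply]

variable [StarRing 𝔸] [StarModule ℝ 𝔸] [ContinuousStar 𝔸]

lemma commutatorFlow_eq_conj_of_continuous (h : 0 ≤ T) {H₀ H₁ : 𝔸} (hH₀ : star H₀ = -H₀)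
    (hH₁ : star H₁ = -H₁) (ρ₀ : 𝔸) {u : Control T} {f : ℝ → ℝ} (hf : Continuous f)
    (huf : ∀ᵐ s ∂(volume : Measure ℝ).restrict (Set.Icc 0 T), u s = f s) :
    commutatorFlow h H₀ H₁ ρ₀ u = propagator h H₀ H₁ u * ρ₀ * star (propagator h H₀ H₁ u) := by
  obtain ⟨y, hy₀, hy, hyT⟩ := exists_hasDerivAt_eq_linearFlow h (ContinuousLinearMap.mul ℝ 𝔸 H₀)
    (ContinuousLinearMap.mul ℝ 𝔸 H₁) 1 hf huf
  rw [propagator, ← hyT]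
  refine linearFlow_eq_of_hasDerivAt h _ _ ρ₀ hf huf
    (y := fun t => y t * ρ₀ * star (y t)) (by simp [hy₀]) (fun t ht => ?_) _
  have hskew : star (H₀ + f t • H₁) = -(H₀ + f t • H₁) := by
    rw [star_add, star_smul, hH₀, hH₁, star_trivial, smul_neg, neg_add]
  rw [commutatorCLM_add_smul]
  refine hasDerivAt_conj_of_linear hskew ?_ ρ₀
  simpa only [ContinuousLinearMap.mul_apply', add_mul, smul_mul_assoc] using hy t ht

lemma commutatorFlow_eq_conj (h : 0 ≤ T) {H₀ H₁ : 𝔸} (hH₀ : star H₀ = -H₀)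
    (hH₁ : star H₁ = -H₁) (ρ₀ : 𝔸) (u : Control T) :
    commutatorFlow h H₀ H₁ ρ₀ u = propagator h H₀ H₁ u * ρ₀ * star (propagator h H₀ H₁ u) := by
  have hdense := Lp.boundedContinuousFunction_dense ℝ
    ((volume : Measure ℝ).restrict (Set.Icc 0 T)) (p := 2) (by simp)
  have hprop := (contDiff_propagator h H₀ H₁).continuous
  refine congrFun (Continuous.ext_on hdense (contDiff_commutatorFlow h H₀ H₁ ρ₀).continuous
    (g := fun u => propagator h H₀ H₁ u * ρ₀ * star (propagator h H₀ H₁ u)) (by fun_prop)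
    fun u hu => ?_) u
  obtain ⟨f, hf⟩ := Lp.mem_boundedContinuousFunction_iff.1 hu
  refine commutatorFlow_eq_conj_of_continuous h hH₀ hH₁ ρ₀ f.continuous ?_
  rw [← hf]
  exact ContinuousMap.coeFn_toAEEqFun _ f.toContinuousMap

lemma propagator_mul_star (h : 0 ≤ T) {H₀ H₁ : 𝔸} (hH₀ : star H₀ = -H₀) (hH₁ : star H₁ = -H₁)
    (u : Control T) : propagator h H₀ H₁ u * star (propagator h H₀ H₁ u) = 1 := by
  simpa only [commutatorFlow_one, mul_one] using (commutatorFlow_eq_conj h hH₀ hH₁ 1 u).symm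

end Commutator

section EndPoint

attribute [local instance] Matrix.linftyOpNormedRing Matrix.linftyOpNormedAlgebra

variable {n : ℕ} {T : ℝ}

lemma isTrajectory_iff_eq_linearFlow (h : 0 ≤ T) (H₀ H₁ ρ₀ : Matrix (Fin n) (Fin n) ℂ)
    (u : Control T) {ρ : ℝ → Matrix (Fin n) (Fin n) ℂ} (hρ : ContinuousOn ρ (Set.Icc 0 T)) :
    IsTrajectory T H₀ H₁ ρ₀ u ρ ↔
      ⟨fun t => ρ t, continuousOn_iff_continuous_domRestrict.1 hρ⟩ =
        linearFlow h (commutatorCLM H₀) (commutatorCLM H₁) ρ₀ u := by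
  set x : C(Set.Icc (0 : ℝ) T, Matrix (Fin n) (Fin n) ℂ) :=
    ⟨fun t => ρ t, continuousOn_iff_continuous_domRestrict.1 hρ⟩
  have hentry : ∀ (t : Set.Icc (0 : ℝ) T) (j k : Fin n),
      ∫ s in (0 : ℝ)..t, ((H₀ + u s • H₁) * ρ s - ρ s * (H₀ + u s • H₁)) j k =
        (∫ s in (0 : ℝ)..t, (commutatorCLM H₀ (Set.IccExtend h x s) +
          u s • commutatorCLM H₁ (Set.IccExtend h x s))) j k := by
    intro t j k
    refine Eq.trans ?_ (ContinuousLinearMap.intervalIntegral_comp_comm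
      (Matrix.entryLinearMap ℝ ℂ j k).toContinuousLinearMap
      (intervalIntegrable_drift_add_control h _ _ u x t))
    refine intervalIntegral.integral_congr fun s hs => ?_
    rw [Set.uIcc_of_le t.2.1] at hs
    rw [commutatorCLM_add_smul, Set.IccExtend_of_mem h _ ⟨hs.1, hs.2.trans t.2.2⟩]
    rfl
  rw [eq_linearFlow_iff, IsTrajectory, and_iff_right hρ, Subtype.forall]
  refine forall₂_congr fun t ht => ?_
  rw [← Matrix.ext_iff]
  refine forall₂_congr fun j k => ?_
  rw [hentry ⟨t, ht⟩]
  rfl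

lemma endPoint_eq_commutatorFlow (h : 0 ≤ T) (H₀ H₁ ρ₀ : Matrix (Fin n) (Fin n) ℂ) :
    endPoint T H₀ H₁ ρ₀ = commutatorFlow h H₀ H₁ ρ₀ := by
  funext u
  have hexists : ∃ σ, ∃ ρ, IsTrajectory T H₀ H₁ ρ₀ u ρ ∧ ρ T = σ := by
    let x := linearFlow h (commutatorCLM H₀) (commutatorCLM H₁) ρ₀ u
    refine ⟨_, Set.IccExtend h x, (isTrajectory_iff_eq_linearFlow h H₀ H₁ ρ₀ u
      x.continuous.Icc_extend'.continuousOn).2 ?_, rfl⟩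
    ext1 t
    exact Set.IccExtend_val h _ t
  obtain ⟨ρ, hρ, hρT : ρ T = endPoint T H₀ H₁ ρ₀ u⟩ := Classical.epsilon_spec hexists
  rw [commutatorFlow, ← (isTrajectory_iff_eq_linearFlow h H₀ H₁ ρ₀ u hρ.1).1 hρ, ← hρT]
  rfl

end EndPoint

section Variation

variable {𝔸 : Type*} [NormedRing 𝔸] [NormedAlgebra ℝ 𝔸] {H : Type*}
  [NormedAddCommGroup H] [NormedSpace ℝ H]

lemma fderiv_mul_apply {f g : H → 𝔸} {u : H} (hf : DifferentiableAt ℝ f u)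
    (hg : DifferentiableAt ℝ g u) (v : H) :
    fderiv ℝ (fun u => f u * g u) u v = f u * fderiv ℝ g u v + fderiv ℝ f u v * g u := by
  rw [fderiv_fun_mul' hf hg]
  rfl

lemma fderiv_lie_apply {f g : H → 𝔸} {u : H} (hf : DifferentiableAt ℝ f u)
    (hg : DifferentiableAt ℝ g u) (v : H) :
    fderiv ℝ (fun u => ⁅f u, g u⁆) u v = ⁅fderiv ℝ f u v, g u⁆ + ⁅f u, fderiv ℝ g u v⁆ := by
  simp only [Ring.lie_def]
  rw [fderiv_fun_sub (hf.fun_mul hg) (hg.fun_mul hf), sub_apply, fderiv_mul_apply hf hg,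
    fderiv_mul_apply hg hf]
  abel

variable [StarRing 𝔸] [StarModule ℝ 𝔸] [ContinuousStar 𝔸]

lemma fderiv_star_apply (f : H → 𝔸) (u v : H) :
    fderiv ℝ (fun u => star (f u)) u v = star (fderiv ℝ f u v) := by
  rw [fderiv_star]
  rfl

/-- The (right-invariant) Maurer–Cartan form `dU · U⁻¹` of a unitary-valued map `U`: the
infinitesimal generator of the conjugation action along `U`. -/
def maurerCartan (U : H → 𝔸) (u v : H) : 𝔸 :=
  fderiv ℝ U u v * star (U u)

lemma star_maurerCartan {U : H → 𝔸} {u : H} (hU : DifferentiableAt ℝ U u)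
    (hunitary : ∀ u, U u * star (U u) = 1) (v : H) :
    star (maurerCartan U u v) = -maurerCartan U u v := by
  have hderiv := fderiv_mul_apply hU hU.star v
  simp only [hunitary, fderiv_const_apply, zero_apply, fderiv_star_apply] at hderiv
  rw [maurerCartan, star_mul, star_star]
  exact eq_neg_of_add_eq_zero_left hderiv.symm

lemma fderiv_conj_apply {U : H → 𝔸} {u : H} (hU : DifferentiableAt ℝ U u)
    (hunitary : ∀ u, U u * star (U u) = 1) (hunitary' : ∀ u, star (U u) * U u = 1) (ρ₀ : 𝔸)
    (v : H) :
    fderiv ℝ (fun u => U u * ρ₀ * star (U u)) u v =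
      ⁅maurerCartan U u v, U u * ρ₀ * star (U u)⁆ := by
  have hderiv : fderiv ℝ (fun u => U u * ρ₀) u v = fderiv ℝ U u v * ρ₀ := by
    rw [fderiv_mul_const' hU]
    rfl
  have hgen : star (fderiv ℝ U u v) = -(star (U u) * maurerCartan U u v) := by
    rw [← mul_neg, ← star_maurerCartan hU hunitary, maurerCartan, star_mul, star_star, ← mul_assoc,
      hunitary', one_mul]
  rw [fderiv_mul_apply (hU.mul_const ρ₀) hU.star, fderiv_star_apply, hderiv, hgen, Ring.lie_def,
    maurerCartan]
  calc _ = fderiv ℝ U u v * 1 * ρ₀ * star (U u)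
        - U u * ρ₀ * star (U u) * (fderiv ℝ U u v * star (U u)) := by noncomm_ring
    _ = _ := by
      rw [← hunitary' u]
      noncomm_ring

lemma differentiable_maurerCartan {U : H → 𝔸} (hU : ContDiff ℝ 2 U) (v : H) :
    Differentiable ℝ fun u => maurerCartan U u v :=
  ((hU.fderiv_right (m := 1) le_rfl).differentiable one_ne_zero).clm_apply
    (differentiable_const v) |>.fun_mul (hU.differentiable two_ne_zero).star

lemma fderiv_fderiv_conj_apply {U : H → 𝔸} (hU : ContDiff ℝ 2 U)
    (hunitary : ∀ u, U u * star (U u) = 1) (hunitary' : ∀ u, star (U u) * U u = 1) (ρ₀ : 𝔸)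
    (u v : H) :
    fderiv ℝ (fderiv ℝ fun u => U u * ρ₀ * star (U u)) u v v =
      ⁅fderiv ℝ (fun u => maurerCartan U u v) u v, U u * ρ₀ * star (U u)⁆ +
        ⁅maurerCartan U u v, ⁅maurerCartan U u v, U u * ρ₀ * star (U u)⁆⁆ := by
  have hU₁ : Differentiable ℝ U := hU.differentiable two_ne_zero
  have hE : ContDiff ℝ 2 fun u => U u * ρ₀ * star (U u) :=
    (hU.mul contDiff_const).mul ((starL' ℝ (A := 𝔸)).toContinuousLinearMap.contDiff.comp hU)
  have hdE : DifferentiableAt ℝ (fderiv ℝ fun u => U u * ρ₀ * star (U u)) u :=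
    (hE.fderiv_right (m := 1) le_rfl).differentiable one_ne_zero u
  calc _ = fderiv ℝ (fun u => fderiv ℝ (fun u => U u * ρ₀ * star (U u)) u v) u v := by
        rw [fderiv_clm_apply hdE (differentiableAt_const v)]
        simp
    _ = fderiv ℝ (fun u => ⁅maurerCartan U u v, U u * ρ₀ * star (U u)⁆) u v := by
        simp only [fderiv_conj_apply (hU₁ _) hunitary hunitary']
    _ = _ := by
        rw [fderiv_lie_apply (differentiable_maurerCartan hU v u)
          (hE.differentiable two_ne_zero u), fderiv_conj_apply (hU₁ u) hunitary hunitary']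

end Variation

section CriticalPoint

lemma eq_diagonal_of_commute_diagonal {m R : Type*} [Fintype m] [DecidableEq m] [CommRing R]
    [IsDomain R] {d : m → R} (hd : Function.Injective d) {X : Matrix m m R}
    (hX : Commute X (Matrix.diagonal d)) : X = Matrix.diagonal X.diag := by
  ext i j
  rcases eq_or_ne i j with rfl | hij
  · rw [Matrix.diagonal_apply_eq, Matrix.diag_apply]
  · have hentry := congrFun (congrFun hX.eq i) j
    rw [Matrix.mul_diagonal, Matrix.diagonal_mul, mul_comm, ← sub_eq_zero, ← sub_mul] at hentry
    rw [Matrix.diagonal_apply_ne _ hij]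
    exact (mul_eq_zero.1 hentry).resolve_left (sub_ne_zero.2 fun h => hij (hd h).symm)

lemma commute_of_commute_simple {m 𝕜 : Type*} [Fintype m] [DecidableEq m] [RCLike 𝕜]
    {θ X Y : Matrix m m 𝕜} (hθ : θ.IsHermitian) (hsimple : Function.Injective hθ.eigenvalues)
    (hX : Commute X θ) (hY : Commute Y θ) : Commute X Y := by
  let e := Unitary.conjStarAlgAut 𝕜 (Matrix m m 𝕜) (star hθ.eigenvectorUnitary)
  have hdiag : ∀ Z, Commute Z θ → e Z = Matrix.diagonal (e Z).diag := fun Z hZ => by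
    refine eq_diagonal_of_commute_diagonal (RCLike.ofReal_injective.comp hsimple) ?_
    rw [← hθ.conjStarAlgAut_star_eigenvectorUnitary]
    exact hZ.map e
  have hcomm : Commute (e X) (e Y) := by
    rw [hdiag X hX, hdiag Y hY]
    exact Matrix.commute_diagonal _ _
  exact hcomm.of_map e.injective

lemma trace_lie_mul {m R : Type*} [Fintype m] [CommRing R] (A B C : Matrix m m R) :
    (⁅A, B⁆ * C).trace = (A * ⁅B, C⁆).trace := by
  rw [Ring.lie_def, Ring.lie_def, sub_mul, mul_sub, Matrix.trace_sub, Matrix.trace_sub,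
    mul_assoc B, Matrix.trace_mul_comm B]
  simp only [mul_assoc]

variable {n : ℕ}

section TangentSpace

variable {ρ X Y : Matrix (Fin n) (Fin n) ℂ}

lemma lie_mem_su (hX : X.IsHermitian) (hY : Y.IsHermitian) : ⁅X, Y⁆ ∈ su n := by
  refine ⟨?_, ?_⟩
  · rw [Ring.lie_def, Matrix.conjTranspose_sub, Matrix.conjTranspose_mul,
      Matrix.conjTranspose_mul, hX.eq, hY.eq, neg_sub]
  · rw [Ring.lie_def, Matrix.trace_sub, Matrix.trace_mul_comm, sub_self]

lemma isHermitian_lie (hX : Xᴴ = -X) (hY : Y.IsHermitian) : (⁅X, Y⁆).IsHermitian := by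
  rw [Matrix.IsHermitian, Ring.lie_def, Matrix.conjTranspose_sub, Matrix.conjTranspose_mul,
    Matrix.conjTranspose_mul, hX, hY.eq]
  noncomm_ring

open scoped ComplexOrder in
lemma eq_zero_of_re_trace_conjTranspose_mul_self (h : (Xᴴ * X).trace.re = 0) : X = 0 := by
  rw [← Matrix.trace_conjTranspose_mul_self_eq_zero_iff]
  have hnonneg := (Matrix.posSemidef_conjTranspose_mul_self X).trace_nonneg
  exact Complex.ext h (Complex.nonneg_iff.1 hnonneg).2.symm

lemma exists_mem_su_lie_eq (hX : Xᴴ = -X) (ρ : Matrix (Fin n) (Fin n) ℂ) :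
    ∃ Ω ∈ su n, ⁅X, ρ⁆ = ⁅Ω, ρ⁆ := by
  rcases Nat.eq_zero_or_pos n with rfl | hn
  · exact ⟨0, zero_mem _, Subsingleton.elim _ _⟩
  have hn' : (n : ℂ) ≠ 0 := by exact_mod_cast hn.ne'
  refine ⟨X - (X.trace / n) • (1 : Matrix (Fin n) (Fin n) ℂ), ⟨?_, ?_⟩, ?_⟩
  · have htrace : star X.trace = -X.trace := by
      rw [← Matrix.trace_conjTranspose, hX, Matrix.trace_neg]
    rw [Matrix.conjTranspose_sub, Matrix.conjTranspose_smul, Matrix.conjTranspose_one, hX,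
      star_div₀, htrace, star_natCast, neg_div, neg_smul]
    abel
  · rw [Matrix.trace_sub, Matrix.trace_smul, Matrix.trace_one, Fintype.card_fin, smul_eq_mul,
      div_mul_cancel₀ _ hn', sub_self]
  · simp only [Ring.lie_def, sub_mul, mul_sub, smul_mul_assoc, mul_smul_comm, one_mul, mul_one]
    abel

lemma adMap_neg_eq_lie (ρ Ω : Matrix (Fin n) (Fin n) ℂ) : adMap ρ (-Ω) = ⁅Ω, ρ⁆ := by
  simp only [adMap, Ring.lie_def, LinearMap.coe_mk, AddHom.coe_mk]
  noncomm_ring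

lemma lie_mem_tangentSpace (hX : Xᴴ = -X) (ρ : Matrix (Fin n) (Fin n) ℂ) :
    ⁅X, ρ⁆ ∈ tangentSpace ρ := by
  obtain ⟨Ω, hΩ, hlie⟩ := exists_mem_su_lie_eq hX ρ
  exact ⟨-Ω, neg_mem hΩ, (adMap_neg_eq_lie ρ Ω).trans hlie.symm⟩

lemma exists_tangentSpace_section (ρ : Matrix (Fin n) (Fin n) ℂ) :
    ∃ s : tangentSpace ρ →ₗ[ℝ] Matrix (Fin n) (Fin n) ℂ,
      ∀ η, s η ∈ su n ∧ ⁅s η, ρ⁆ = (η : Matrix (Fin n) (Fin n) ℂ) := by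
  obtain ⟨s, hs⟩ := ((adMap ρ).submoduleMap (su n)).exists_rightInverse_of_surjective
    (LinearMap.range_eq_top.2 ((adMap ρ).submoduleMap_surjective (su n)))
  refine ⟨-((su n).subtype ∘ₗ s), fun η => ⟨neg_mem (s η).2, ?_⟩⟩
  have hη : adMap ρ (s η) = η := congrArg Subtype.val (LinearMap.congr_fun hs η)
  calc ⁅-(s η : Matrix (Fin n) (Fin n) ℂ), ρ⁆ = adMap ρ (s η) := by
        rw [← adMap_neg_eq_lie, neg_neg]
    _ = η := hη

lemma map_conjStarAlgAut_su (U : Matrix.unitaryGroup (Fin n) ℂ) :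
    (su n).map (Unitary.conjStarAlgAut ℝ _ U).toAlgEquiv.toLinearMap = su n := by
  have hmem : ∀ (V : Matrix.unitaryGroup (Fin n) ℂ), ∀ Ω ∈ su n,
      Unitary.conjStarAlgAut ℝ (Matrix (Fin n) (Fin n) ℂ) V Ω ∈ su n := by
    rintro V Ω ⟨hΩ, htrace⟩
    refine ⟨?_, ?_⟩
    · rw [← Matrix.star_eq_conjTranspose] at hΩ ⊢
      rw [← map_star, hΩ, map_neg]
    · rw [Unitary.conjStarAlgAut_apply, Matrix.trace_mul_cycle, Unitary.coe_star_mul_self, one_mul,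
        htrace]
  apply le_antisymm
  · rintro _ ⟨Ω, hΩ, rfl⟩
    exact hmem U Ω hΩ
  · intro Ω hΩ
    refine ⟨_, hmem (star U) Ω hΩ, ?_⟩
    rw [← Unitary.conjStarAlgAut_symm]
    exact (Unitary.conjStarAlgAut ℝ _ U).apply_symm_apply Ω

lemma finrank_tangentSpace_conj (ρ : Matrix (Fin n) (Fin n) ℂ)
    (U : Matrix.unitaryGroup (Fin n) ℂ) :
    Module.finrank ℝ (tangentSpace (Unitary.conjStarAlgAut ℝ _ U ρ)) =
      Module.finrank ℝ (tangentSpace ρ) := by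
  let e := (Unitary.conjStarAlgAut ℝ (Matrix (Fin n) (Fin n) ℂ) U).toAlgEquiv
  have hcomm : adMap (e ρ) ∘ₗ e.toLinearMap = e.toLinearMap ∘ₗ adMap ρ := by
    ext1 Ω
    change e ρ * e Ω - e Ω * e ρ = e (ρ * Ω - Ω * ρ)
    rw [map_sub, map_mul, map_mul]
  have hmap : tangentSpace (e ρ) = (tangentSpace ρ).map e.toLinearMap := by
    rw [tangentSpace, ← map_conjStarAlgAut_su U, ← Submodule.map_comp]
    exact (congrArg (su n).map hcomm).trans (Submodule.map_comp _ _ _)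
  exact (congrArg (fun S : Submodule ℝ (Matrix (Fin n) (Fin n) ℂ) => Module.finrank ℝ S) hmap).trans
    (LinearEquiv.finrank_map_eq e.toLinearEquiv _)

end TangentSpace

/-- The functional `X ↦ Re tr (X θ)`; the cost is its composition with the end-point map. -/
def traceCLM (θ : Matrix (Fin n) (Fin n) ℂ) : Matrix (Fin n) (Fin n) ℂ →L[ℝ] ℝ :=
  LinearMap.toContinuousLinearMap
    (Complex.reLm ∘ₗ Matrix.traceLinearMap (Fin n) ℝ ℂ ∘ₗ LinearMap.mulRight ℝ θ)

variable {θ ρ ρ₀ : Matrix (Fin n) (Fin n) ℂ}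

lemma traceCLM_apply (θ X : Matrix (Fin n) (Fin n) ℂ) : traceCLM θ X = (X * θ).trace.re := rfl

lemma traceCLM_lie_eq_zero (hcomm : Commute θ ρ) (X : Matrix (Fin n) (Fin n) ℂ) :
    traceCLM θ ⁅X, ρ⁆ = 0 := by
  rw [traceCLM_apply, trace_lie_mul, commute_iff_lie_eq.1 hcomm.symm, mul_zero, Matrix.trace_zero,
    Complex.zero_re]

lemma isHermitian_of_mem_orbit (hρ₀ : ρ₀.IsHermitian) (hρ : ρ ∈ orbit ρ₀) : ρ.IsHermitian := by
  obtain ⟨U, -, rfl⟩ := hρ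
  exact Matrix.isHermitian_mul_mul_conjTranspose U hρ₀

lemma finrank_tangentSpace_of_mem_orbit (hρ : ρ ∈ orbit ρ₀) :
    Module.finrank ℝ (tangentSpace ρ) = orbitDim ρ₀ := by
  obtain ⟨U, hU, rfl⟩ := hρ
  exact finrank_tangentSpace_conj ρ₀ ⟨U, (Matrix.mem_specialUnitaryGroup_iff.1 hU).1⟩

lemma commute_of_isKinematicCritical (hρ₀ : ρ₀.IsHermitian) (hθ : θ.IsHermitian)
    (hcrit : IsKinematicCritical θ ρ₀ ρ) : Commute θ ρ := by
  have hsu := lie_mem_su hθ (isHermitian_of_mem_orbit hρ₀ hcrit.1)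
  have hfderiv : fderiv ℝ (kinematicCost θ) ρ = traceCLM θ := (traceCLM θ).hasFDerivAt.fderiv
  have hzero := hcrit.2 _ (lie_mem_tangentSpace hsu.1 ρ)
  rw [hfderiv, traceCLM_apply, trace_lie_mul] at hzero
  rw [commute_iff_lie_eq]
  apply eq_zero_of_re_trace_conjTranspose_mul_self
  rw [hsu.1, ← hzero, neg_mul, ← mul_neg, Ring.lie_def ρ, ← neg_sub (θ * ρ), ← Ring.lie_def]

/-- The bilinear form `(A, B) ↦ Re tr (⁅A, ⁅B, ρ⁆⁆ θ)` on generators of the conjugation action: its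
restriction to the diagonal is the second variation of the cost along the orbit. -/
def hessianForm (θ ρ : Matrix (Fin n) (Fin n) ℂ) :
    LinearMap.BilinForm ℝ (Matrix (Fin n) (Fin n) ℂ) :=
  LinearMap.mk₂ ℝ (fun A B => traceCLM θ ⁅A, ⁅B, ρ⁆⁆)
    (fun A A' B => by
      rw [← map_add]
      congr 1
      simp only [Ring.lie_def]
      noncomm_ring)
    (fun c A B => by
      simp only [← map_smul, Ring.lie_def, smul_mul_assoc, mul_smul_comm, smul_sub])
    (fun A B B' => by
      rw [← map_add]
      congr 1
      simp only [Ring.lie_def]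
      noncomm_ring)
    (fun c A B => by
      simp only [← map_smul, Ring.lie_def, smul_mul_assoc, mul_smul_comm, mul_sub, sub_mul,
        smul_sub])

lemma hessianForm_apply (A B : Matrix (Fin n) (Fin n) ℂ) :
    hessianForm θ ρ A B = traceCLM θ ⁅A, ⁅B, ρ⁆⁆ := rfl

lemma hessianForm_comm (hcomm : Commute θ ρ) (A B : Matrix (Fin n) (Fin n) ℂ) :
    hessianForm θ ρ A B = hessianForm θ ρ B A := by
  have hjacobi : ⁅A, ⁅B, ρ⁆⁆ = ⁅⁅A, B⁆, ρ⁆ + ⁅B, ⁅A, ρ⁆⁆ := by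
    simp only [Ring.lie_def]
    noncomm_ring
  rw [hessianForm_apply, hessianForm_apply, hjacobi, map_add, traceCLM_lie_eq_zero hcomm, zero_add]

lemma hessianForm_self_congr (hcomm : Commute θ ρ) {A B : Matrix (Fin n) (Fin n) ℂ}
    (hlie : ⁅A, ρ⁆ = ⁅B, ρ⁆) : hessianForm θ ρ A A = hessianForm θ ρ B B := by
  calc hessianForm θ ρ A A = hessianForm θ ρ A B := by
        rw [hessianForm_apply, hlie, ← hessianForm_apply]
    _ = hessianForm θ ρ B A := hessianForm_comm hcomm A B
    _ = hessianForm θ ρ B B := by rw [hessianForm_apply, hlie, ← hessianForm_apply]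

lemma lie_eq_zero_of_hessianForm_eq_zero (hρ : ρ.IsHermitian) (hθ : θ.IsHermitian)
    (hsimple : Function.Injective hθ.eigenvalues) (hcomm : Commute θ ρ)
    {A : Matrix (Fin n) (Fin n) ℂ} (hA : Aᴴ = -A)
    (hzero : ∀ B ∈ su n, hessianForm θ ρ B A = 0) : ⁅A, ρ⁆ = 0 := by
  have hη : (⁅A, ρ⁆).IsHermitian := isHermitian_lie hA hρ
  have hηθ : Commute ⁅A, ρ⁆ θ := by
    have hsu := lie_mem_su hη hθ
    rw [commute_iff_lie_eq]
    apply eq_zero_of_re_trace_conjTranspose_mul_self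
    rw [hsu.1, neg_mul, Matrix.trace_neg, Complex.neg_re, ← trace_lie_mul, ← traceCLM_apply,
      ← hessianForm_apply, hzero _ hsu, neg_zero]
  have hηρ : Commute ⁅A, ρ⁆ ρ := commute_of_commute_simple hθ hsimple hηθ hcomm.symm
  apply eq_zero_of_re_trace_conjTranspose_mul_self
  rw [hη.eq, trace_lie_mul, commute_iff_lie_eq.1 hηρ.symm, mul_zero, Matrix.trace_zero,
    Complex.zero_re]

lemma exists_nondegenerate_hessian (hρ : ρ.IsHermitian) (hθ : θ.IsHermitian)
    (hsimple : Function.Injective hθ.eigenvalues) (hcomm : Commute θ ρ) :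
    ∃ b : LinearMap.BilinForm ℝ (tangentSpace ρ), b.IsSymm ∧ b.SeparatingLeft ∧
      ∀ (A : Matrix (Fin n) (Fin n) ℂ) (hA : Aᴴ = -A),
        b ⟨_, lie_mem_tangentSpace hA ρ⟩ ⟨_, lie_mem_tangentSpace hA ρ⟩ =
          traceCLM θ ⁅A, ⁅A, ρ⁆⁆ := by
  obtain ⟨s, hs⟩ := exists_tangentSpace_section ρ
  refine ⟨(hessianForm θ ρ).compl₁₂ s s, ⟨fun η η' => hessianForm_comm hcomm (s η) (s η')⟩,
    fun η hη => Subtype.ext ?_, fun A hA => ?_⟩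
  · rw [← (hs η).2, Submodule.coe_zero]
    refine lie_eq_zero_of_hessianForm_eq_zero hρ hθ hsimple hcomm (hs η).1.1 fun B hB => ?_
    have hηB := hη ⟨_, lie_mem_tangentSpace hB.1 ρ⟩
    rwa [LinearMap.compl₁₂_apply, hessianForm_apply, (hs _).2, ← hessianForm_apply,
      hessianForm_comm hcomm] at hηB
  · rw [LinearMap.compl₁₂_apply, ← hessianForm_apply]
    exact hessianForm_self_congr hcomm (hs ⟨_, lie_mem_tangentSpace hA ρ⟩).2

end CriticalPoint

section InverseFunction

variable {E F : Type*} [NormedAddCommGroup E] [NormedSpace ℝ E] [CompleteSpace E]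
  [NormedAddCommGroup F] [NormedSpace ℝ F]

theorem exists_openPartialHomeomorph_contDiffOn_symm {f : E → F} {a : E} {s : Set E}
    (hs : IsOpen s) (ha : a ∈ s) (hf : ContDiffOn ℝ ∞ f s) {f' : E ≃L[ℝ] F}
    (hf' : HasFDerivAt f (f' : E →L[ℝ] F) a) :
    ∃ e : OpenPartialHomeomorph E F, a ∈ e.source ∧ e.source ⊆ s ∧ (∀ x, e x = f x) ∧
      ContDiffOn ℝ ∞ e e.source ∧ ContDiffOn ℝ ∞ e.symm e.target := by
  have hfa : ContDiffAt ℝ ∞ f a := hf.contDiffAt (hs.mem_nhds ha)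
  -- The inverse is smooth at the image of each point with invertible derivative, so we restrict to
  -- the open set of such points.
  have hopen : IsOpen (s ∩ fderiv ℝ f ⁻¹' Set.range ((↑) : (E ≃L[ℝ] F) → E →L[ℝ] F)) :=
    (hf.continuousOn_fderiv_of_isOpen hs (by simp)).isOpen_inter_preimage hs
      ContinuousLinearEquiv.isOpen
  let e := (hfa.toOpenPartialHomeomorph f hf' (by simp)).restrOpen _ hopen
  have hsource : ∀ x ∈ e.source, x ∈ s ∧ ∃ g : E ≃L[ℝ] F, (g : E →L[ℝ] F) = fderiv ℝ f x :=
    fun x hx => hx.2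
  refine ⟨e, ⟨hfa.mem_toOpenPartialHomeomorph_source hf' (by simp), ha, f', hf'.fderiv.symm⟩,
    fun x hx => (hsource x hx).1, fun _ => rfl, hf.mono fun x hx => (hsource x hx).1,
    fun y hy => ?_⟩
  obtain ⟨hx, g, hg⟩ := hsource _ (e.map_target hy)
  have hfx : ContDiffAt ℝ ∞ f (e.symm y) := hf.contDiffAt (hs.mem_nhds hx)
  have hg' : HasFDerivAt f (g : E →L[ℝ] F) (e.symm y) := by
    rw [hg]
    exact (hfx.differentiableAt (by simp)).hasFDerivAt
  exact (e.contDiffAt_symm hy hg' hfx).contDiffWithinAt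

theorem exists_contDiffOn_sqrt {A : Type*} [NormedRing A] [NormedAlgebra ℝ A] [CompleteSpace A] :
    ∃ (r : A → A) (s : Set A), IsOpen s ∧ 1 ∈ s ∧ r 1 = 1 ∧ ContDiffOn ℝ ∞ r s ∧
      (∀ x ∈ s, r x * r x = x) ∧ ∀ᶠ z in nhds (1 : A), r (z * z) = z := by
  have hsq : ContDiff ℝ ∞ fun x : A => x * x := contDiff_id.mul contDiff_id
  have hderiv : HasFDerivAt (fun x : A => x * x)
      ((ContinuousLinearEquiv.smulLeft (Units.mk0 (2 : ℝ) two_ne_zero) : A ≃L[ℝ] A) :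
        A →L[ℝ] A) 1 := by
    refine ((hasFDerivAt_id (1 : A)).mul' (hasFDerivAt_id (1 : A))).congr_fderiv ?_
    ext x
    simp [Units.smul_def, two_smul]
  obtain ⟨e, h1, -, he, -, hsymm⟩ := exists_openPartialHomeomorph_contDiffOn_symm isOpen_univ
    (Set.mem_univ _) hsq.contDiffOn hderiv
  have he1 : e 1 = 1 := by rw [he, mul_one]
  refine ⟨e.symm, e.target, e.open_target, he1 ▸ e.map_source h1, ?_, hsymm, fun x hx => ?_, ?_⟩
  · simpa only [he1] using e.left_inv h1
  · rw [← he, e.right_inv hx]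
  · filter_upwards [e.open_source.mem_nhds h1] with z hz
    rw [← he, e.left_inv hz]

end InverseFunction

section Factorization

variable {E A : Type*} [NormedAddCommGroup E] [NormedSpace ℝ E]
  [NormedRing A] [NormedAlgebra ℝ A] [CompleteSpace A] [StarRing A] [ContinuousStar A]

theorem exists_contDiffOn_star_mul_mul_eq {S : E → A} (hS : ContDiff ℝ ∞ S)
    (hstar : ∀ x, star (S x) = S x) {a : Aˣ} {x₀ : E} (hx₀ : S x₀ = a) :
    ∃ (P : E → A) (s : Set E), IsOpen s ∧ x₀ ∈ s ∧ ContDiffOn ℝ ∞ P s ∧ P x₀ = 1 ∧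
      ∀ x ∈ s, star (P x) * a * P x = S x := by
  obtain ⟨r, t, ht, h1t, hr1, hr, hr_sq, hr_uniq⟩ := exists_contDiffOn_sqrt (A := A)
  have ha : star (a : A) = a := hx₀ ▸ hstar x₀
  let X : E → A := fun x => ↑a⁻¹ * S x
  have hX : ContDiff ℝ ∞ X := contDiff_const.mul hS
  have hXx₀ : X x₀ = 1 := by simp only [X, hx₀, Units.inv_mul]
  let P : E → A := fun x => r (X x)
  have hPx₀ : P x₀ = 1 := by simp only [P, hXx₀, hr1]
  have hopen : IsOpen (X ⁻¹' t) := ht.preimage hX.continuous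
  have hmem : x₀ ∈ X ⁻¹' t := by rwa [Set.mem_preimage, hXx₀]
  have hP : ContDiffOn ℝ ∞ P (X ⁻¹' t) := hr.comp hX.contDiffOn fun _ hx => hx
  have haX : ∀ x, a * X x = S x := fun x => by simp only [X, Units.mul_inv_cancel_left]
  have hXstar : ∀ x, ↑a⁻¹ * star (X x) * a = X x := fun x => by
    calc ↑a⁻¹ * star (X x) * a = ↑a⁻¹ * star (a * X x) := by rw [star_mul (a : A), ha, mul_assoc]
      _ = X x := by rw [haX, hstar]
  -- `a⁻¹ P⋆ a` is another square root of `X` near `1`, hence equal to `P`.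
  have hPstar : ∀ᶠ x in nhds x₀, ↑a⁻¹ * star (P x) * a = P x := by
    have hlim : Filter.Tendsto (fun x => ↑a⁻¹ * star (P x) * a) (nhds x₀) (nhds 1) := by
      have hPc : ContinuousAt P x₀ := hP.continuousOn.continuousAt (hopen.mem_nhds hmem)
      have hc : ContinuousAt (fun x => ↑a⁻¹ * star (P x) * (a : A)) x₀ := by fun_prop
      simpa only [hPx₀, star_one, mul_one, Units.inv_mul] using hc.tendsto
    filter_upwards [hlim.eventually hr_uniq, hopen.mem_nhds hmem] with x hx hxt
    rw [← hx]
    congr 1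
    calc ↑a⁻¹ * star (P x) * a * (↑a⁻¹ * star (P x) * a)
        = ↑a⁻¹ * star (P x * P x) * a := by
          rw [star_mul]
          simp only [mul_assoc, Units.mul_inv_cancel_left]
      _ = X x := by rw [show P x * P x = X x from hr_sq _ hxt, hXstar]
  obtain ⟨s, hsub, hs, hx₀s⟩ := mem_nhds_iff.1 (Filter.inter_mem (hopen.mem_nhds hmem) hPstar)
  refine ⟨P, s, hs, hx₀s, hP.mono fun x hx => (hsub hx).1, hPx₀, fun x hx => ?_⟩
  calc star (P x) * a * P x = a * (↑a⁻¹ * star (P x) * a) * P x := by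
        simp only [mul_assoc, Units.mul_inv_cancel_left]
    _ = a * (P x * P x) := by rw [(hsub hx).2, mul_assoc]
    _ = S x := by rw [show P x * P x = X x from hr_sq _ (hsub hx).1, haX]

end Factorization

section TaylorFormula

variable {E F : Type*} [NormedAddCommGroup E] [NormedSpace ℝ E]
  [NormedAddCommGroup F] [NormedSpace ℝ F]

theorem contDiff_intervalIntegral_smul_comp_smul {a : ℝ → ℝ} (ha : Continuous a) {G : E → F}
    (hG : ContDiff ℝ ∞ G) :
    ContDiff ℝ ∞ fun y => ∫ s in (0 : ℝ)..1, a s • G (s • y) := by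
  -- The integral is the value at `0` of the convolution of `a` with the cut-off function
  -- `t ↦ χ t • G (-t • y)`, and convolutions depend smoothly on parameters.
  let χ : ContDiffBump (0 : ℝ) := ⟨1, 2, one_pos, one_lt_two⟩
  let f : ℝ → ℝ := (Set.Ioc (0 : ℝ) 1).indicator a
  let g : E → ℝ → F := fun y t => χ t • G ((-t) • y)
  have hf : LocallyIntegrable f :=
    ((ha.integrableOn_Icc (a := 0) (b := 1)).mono_set Set.Ioc_subset_Icc_self
      |>.integrable_indicator measurableSet_Ioc).locallyIntegrable
  have hg : ContDiff ℝ ∞ (Function.uncurry g) :=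
    (χ.contDiff.comp contDiff_snd).smul (hG.comp (contDiff_snd.neg.smul contDiff_fst))
  have hg_support : ∀ (y : E) (t : ℝ), y ∈ (Set.univ : Set E) → t ∉ Metric.closedBall (0 : ℝ) 2 →
      g y t = 0 := by
    intro y t _ ht
    have : χ t = 0 := χ.zero_of_le_dist (le_of_lt (by simpa using ht))
    simp only [g, this, zero_smul]
  have hconv := contDiffOn_convolution_right_with_param (μ := volume) (n := ⊤)
    (ContinuousLinearMap.lsmul ℝ ℝ) isOpen_univ (isCompact_closedBall _ _) hg_support hf
    hg.contDiffOn
  rw [Set.univ_prod_univ, contDiffOn_univ] at hconv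
  convert hconv.comp (contDiff_id.prodMk (contDiff_const (c := (0 : ℝ)))) using 1
  funext y
  simp only [Function.comp_apply, id, convolution, f, g, ContinuousLinearMap.lsmul_apply]
  rw [intervalIntegral.integral_of_le zero_le_one, ← integral_indicator measurableSet_Ioc]
  refine integral_congr_ae (Filter.Eventually.of_forall fun t => ?_)
  by_cases ht : t ∈ Set.Ioc (0 : ℝ) 1
  · have : χ (-t) = 1 := by
      refine χ.one_of_mem_closedBall ?_
      simp only [mem_closedBall_zero_iff, norm_neg, Real.norm_eq_abs]
      exact abs_le.2 ⟨by linarith [ht.1], ht.2⟩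
    simp [Set.indicator_of_mem ht, this]
  · simp [Set.indicator_of_notMem ht]

theorem eq_add_integral_fderiv_fderiv_of_fderiv_eq_zero {f : E → ℝ} (hf : ContDiff ℝ 2 f)
    (h0 : fderiv ℝ f 0 = 0) (y : E) :
    f y = f 0 + ∫ s in (0 : ℝ)..1, (1 - s) * fderiv ℝ (fderiv ℝ f) (s • y) y y := by
  have hf' : ContDiff ℝ 1 (fderiv ℝ f) := hf.fderiv_right (by norm_num)
  have hray : ∀ s : ℝ, HasDerivAt (fun s : ℝ => s • y) y s := fun s => by
    simpa only [id, one_smul] using (hasDerivAt_id s).smul_const y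
  have hderiv : ∀ s : ℝ, HasDerivAt (fun s : ℝ => f (s • y)) (fderiv ℝ f (s • y) y) s := fun s =>
    ((hf.differentiable (by simp)) _).hasFDerivAt.comp_hasDerivAt s (hray s)
  have hderiv' : ∀ s : ℝ, HasDerivAt (fun s : ℝ => fderiv ℝ f (s • y) y)
      (fderiv ℝ (fderiv ℝ f) (s • y) y y) s := fun s =>
    (ContinuousLinearMap.apply ℝ ℝ y).hasFDerivAt.comp_hasDerivAt s
      (((hf'.differentiable (by simp)) _).hasFDerivAt.comp_hasDerivAt s (hray s))
  have hcont : Continuous fun s : ℝ => fderiv ℝ f (s • y) y :=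
    continuous_iff_continuousAt.2 fun s => (hderiv' s).continuousAt
  have hcont' : Continuous fun s : ℝ => fderiv ℝ (fderiv ℝ f) (s • y) y y := by
    have := hf'.continuous_fderiv (by simp)
    fun_prop
  have hftc : ∫ s in (0 : ℝ)..1, fderiv ℝ f (s • y) y = f y - f 0 := by
    simpa only [one_smul, zero_smul] using intervalIntegral.integral_eq_sub_of_hasDerivAt
      (fun s _ => hderiv s) (hcont.intervalIntegrable 0 1)
  rw [intervalIntegral.integral_mul_deriv_eq_deriv_mul (u := fun s => 1 - s) (u' := fun _ => -1)
    (fun s _ => (hasDerivAt_id s).const_sub 1) (fun s _ => hderiv' s) (by simp)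
    (hcont'.intervalIntegrable _ _)]
  simp [h0, hftc]

end TaylorFormula

section MorseLemma

variable {Y : Type*} [NormedAddCommGroup Y] [InnerProductSpace ℝ Y] [CompleteSpace Y]

/-- The Riesz isomorphism as a continuous linear map. Mathlib's `InnerProductSpace.toDual` is
conjugate-linear also over `ℝ`, and so cannot be composed with derivatives. -/
def rieszCLM (Y : Type*) [NormedAddCommGroup Y] [InnerProductSpace ℝ Y] [CompleteSpace Y] :
    (Y →L[ℝ] ℝ) →L[ℝ] Y where
  toFun := (InnerProductSpace.toDual ℝ Y).symm
  map_add' := map_add _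
  map_smul' c l := by simp
  cont := (InnerProductSpace.toDual ℝ Y).symm.continuous

/-- The operator representing the second derivative of `f` at `x` with respect to the inner
product. -/
def hessianOperator (f : Y → ℝ) (x : Y) : Y →L[ℝ] Y :=
  (rieszCLM Y).comp (fderiv ℝ (fderiv ℝ f) x)

theorem inner_hessianOperator (f : Y → ℝ) (x y z : Y) :
    inner ℝ (hessianOperator f x y) z = fderiv ℝ (fderiv ℝ f) x y z :=
  InnerProductSpace.toDual_symm_apply

theorem contDiff_hessianOperator {f : Y → ℝ} (hf : ContDiff ℝ ∞ f) :
    ContDiff ℝ ∞ (hessianOperator f) :=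
  contDiff_const.clm_comp ((hf.fderiv_right (m := ∞) (by simp)).fderiv_right (by simp))

theorem star_hessianOperator {f : Y → ℝ} {x : Y} (hf : ContDiffAt ℝ 2 f x) :
    star (hessianOperator f x) = hessianOperator f x := by
  rw [ContinuousLinearMap.star_eq_adjoint, ← ContinuousLinearMap.isSelfAdjoint_iff',
    ContinuousLinearMap.isSelfAdjoint_iff_isSymmetric]
  intro y z
  have hsymm : IsSymmSndFDerivAt ℝ f x :=
    hf.isSymmSndFDerivAt minSmoothness_of_isRCLikeNormedField.le
  change inner ℝ (hessianOperator f x y) z = inner ℝ y (hessianOperator f x z)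
  rw [real_inner_comm _ y, inner_hessianOperator, inner_hessianOperator, hsymm y z]

/-- The weighted mean of the Hessians of `f` along the segment from `0` to `y`, which represents
`f` by Taylor's formula when `0` is a critical point. The weight `2 * (1 - s)` has integral `1`. -/
def meanHessianOperator (f : Y → ℝ) (y : Y) : Y →L[ℝ] Y :=
  ∫ s in (0 : ℝ)..1, (2 * (1 - s)) • hessianOperator f (s • y)

theorem contDiff_meanHessianOperator {f : Y → ℝ} (hf : ContDiff ℝ ∞ f) :
    ContDiff ℝ ∞ (meanHessianOperator f) :=
  contDiff_intervalIntegral_smul_comp_smul (by fun_prop) (contDiff_hessianOperator hf)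

theorem meanHessianOperator_zero (f : Y → ℝ) :
    meanHessianOperator f 0 = hessianOperator f 0 := by
  have hweight : ∫ s in (0 : ℝ)..1, 2 * (1 - s) = 1 := by
    rw [intervalIntegral.integral_const_mul, intervalIntegral.integral_sub (by simp) (by simp)]
    norm_num
  simp only [meanHessianOperator, smul_zero, intervalIntegral.integral_smul_const, hweight,
    one_smul]

theorem star_meanHessianOperator {f : Y → ℝ} (hf : ContDiff ℝ 2 f) (y : Y) :
    star (meanHessianOperator f y) = meanHessianOperator f y := by
  simp only [meanHessianOperator, intervalIntegral.integral_of_le zero_le_one]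
  refine ((starL' ℝ : (Y →L[ℝ] Y) ≃L[ℝ] (Y →L[ℝ] Y)).integral_comp_comm _).symm.trans ?_
  refine integral_congr_ae (Filter.Eventually.of_forall fun s => ?_)
  simp [star_hessianOperator hf.contDiffAt]

theorem eq_add_inner_meanHessianOperator {f : Y → ℝ} (hf : ContDiff ℝ ∞ f)
    (h0 : fderiv ℝ f 0 = 0) (y : Y) :
    f y = f 0 + 2⁻¹ * inner ℝ (meanHessianOperator f y y) y := by
  have hint : IntervalIntegrable (fun s : ℝ => (2 * (1 - s)) • hessianOperator f (s • y))
      volume 0 1 := by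
    have := (contDiff_hessianOperator hf).continuous
    exact Continuous.intervalIntegrable (by fun_prop) _ _
  have hmean : inner ℝ (meanHessianOperator f y y) y =
      ∫ s in (0 : ℝ)..1, 2 * ((1 - s) * fderiv ℝ (fderiv ℝ f) (s • y) y y) := by
    rw [real_inner_comm]
    refine (((innerSL ℝ y).comp
      (ContinuousLinearMap.apply ℝ Y y)).intervalIntegral_comp_comm hint).symm.trans ?_
    refine intervalIntegral.integral_congr fun s _ => ?_
    simp [mul_assoc, real_inner_comm (hessianOperator f (s • y) y) y,
      inner_hessianOperator]
  rw [eq_add_integral_fderiv_fderiv_of_fderiv_eq_zero (contDiff_infty.1 hf 2) h0 y, hmean,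
    intervalIntegral.integral_const_mul, inv_mul_cancel_left₀ two_ne_zero]

theorem exists_morsePalais_chart {f : Y → ℝ} (hf : ContDiff ℝ ∞ f) (h0 : fderiv ℝ f 0 = 0)
    (hA : IsUnit (hessianOperator f 0)) :
    ∃ e : OpenPartialHomeomorph Y Y, 0 ∈ e.source ∧ e 0 = 0 ∧
      ContDiffOn ℝ ∞ e e.source ∧ ContDiffOn ℝ ∞ e.symm e.target ∧
      ∀ y ∈ e.source, f y = f 0 + 2⁻¹ * inner ℝ (hessianOperator f 0 (e y)) (e y) := by
  obtain ⟨A, hA⟩ := hA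
  obtain ⟨P, s, hs, h0s, hP, hP0, hfactor⟩ := exists_contDiffOn_star_mul_mul_eq
    (contDiff_meanHessianOperator hf)
    (star_meanHessianOperator (contDiff_infty.1 hf 2)) ((meanHessianOperator_zero f).trans hA.symm)
  have hchart : HasFDerivAt (fun y => P y y)
      ((ContinuousLinearEquiv.refl ℝ Y : Y ≃L[ℝ] Y) : Y →L[ℝ] Y) 0 := by
    have hP' : DifferentiableAt ℝ P 0 :=
      (hP.contDiffAt (hs.mem_nhds h0s)).differentiableAt (by simp)
    refine (hP'.hasFDerivAt.clm_apply (hasFDerivAt_id (0 : Y))).congr_fderiv ?_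
    ext x
    simp [hP0]
  obtain ⟨e, h0e, hes, he, hsmooth, hsmooth'⟩ := exists_openPartialHomeomorph_contDiffOn_symm
    hs h0s (hP.clm_apply contDiffOn_id) hchart
  refine ⟨e, h0e, (he 0).trans (map_zero _), hsmooth, hsmooth', fun y hy => ?_⟩
  rw [eq_add_inner_meanHessianOperator hf h0 y, ← hfactor y (hes hy), he, ← hA,
    ContinuousLinearMap.star_eq_adjoint]
  simp [ContinuousLinearMap.adjoint_inner_left]

end MorseLemma

section Involution

variable {V : Type*} [AddCommGroup V] [Module ℝ V] [FiniteDimensional ℝ V]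

theorem exists_symmetric_involution_of_separatingLeft {b : LinearMap.BilinForm ℝ V}
    (hb : b.IsSymm) (hsep : b.SeparatingLeft) :
    ∃ (J : Module.End ℝ (EuclideanSpace ℝ (Fin (Module.finrank ℝ V))))
      (τ : V ≃ₗ[ℝ] EuclideanSpace ℝ (Fin (Module.finrank ℝ V))),
      J.IsSymmetric ∧ J * J = 1 ∧ ∀ x, b x x = inner ℝ (J (τ x)) (τ x) := by
  have hassoc : QuadraticMap.associated (R := ℝ) b.toQuadraticMap = b :=
    QuadraticMap.associated_left_inverse ℝ hb.eq
  obtain ⟨w, hw, ⟨σ⟩⟩ := QuadraticForm.equivalent_one_neg_one_weighted_sum_squared b.toQuadraticMap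
    (by rwa [hassoc])
  have hw_sq : Matrix.diagonal w * Matrix.diagonal w = 1 := by
    rw [Matrix.diagonal_mul_diagonal, ← Matrix.diagonal_one]
    congr 1 with i
    rcases hw i with h | h <;> simp [h]
  refine ⟨Matrix.toEuclideanLin (Matrix.diagonal w), σ.toLinearEquiv.trans
    (WithLp.linearEquiv 2 ℝ (Fin (Module.finrank ℝ V) → ℝ)).symm, ?_, ?_, fun x => ?_⟩
  · exact Matrix.isSymmetric_toEuclideanLin_iff.2 (Matrix.isHermitian_diagonal w)
  · rw [Module.End.mul_eq_comp, ← Matrix.toLpLin_mul_same, hw_sq, Matrix.toLpLin_one]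
    rfl
  · rw [← LinearMap.BilinMap.toQuadraticMap_apply, ← σ.map_app,
      QuadraticMap.weightedSumSquares_apply, PiLp.inner_apply]
    refine Finset.sum_congr rfl fun i _ => ?_
    simp [Matrix.mulVec_diagonal, mul_left_comm]

variable {Y : Type*} [NormedAddCommGroup Y] [InnerProductSpace ℝ Y] {J : Module.End ℝ Y}

theorem sub_apply_mem_eigenspace_neg_one (hJ : J * J = 1) (x : Y) :
    x - J x ∈ Module.End.eigenspace J (-1) := by
  rw [Module.End.mem_eigenspace_iff, map_sub, ← Module.End.mul_apply, hJ, Module.End.one_apply,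
    neg_one_smul, neg_sub]

theorem apply_eq_self_of_mem_orthogonal_eigenspace_neg_one (hsymm : J.IsSymmetric)
    (hJ : J * J = 1) {x : Y} (hx : x ∈ (Module.End.eigenspace J (-1))ᗮ) : J x = x := by
  have hmem := sub_apply_mem_eigenspace_neg_one hJ x
  have horth : inner ℝ (x - J x) x = 0 := hx _ hmem
  rw [Module.End.mem_eigenspace_iff, neg_one_smul] at hmem
  have hself : inner ℝ (x - J x) (x - J x) = (0 : ℝ) := by
    rw [inner_sub_right, ← hsymm, hmem, inner_neg_left, horth]
    norm_num
  exact (sub_eq_zero.1 (inner_self_eq_zero.1 hself)).symm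

theorem inner_apply_add_self_of_mem_eigenspace_neg_one (hsymm : J.IsSymmetric) (hJ : J * J = 1)
    {x y : Y} (hx : x ∈ Module.End.eigenspace J (-1))
    (hy : y ∈ (Module.End.eigenspace J (-1))ᗮ) :
    inner ℝ (J (x + y)) (x + y) = -‖x‖ ^ 2 + ‖y‖ ^ 2 := by
  have hxy : inner ℝ x y = 0 := hy x hx
  rw [map_add, apply_eq_self_of_mem_orthogonal_eigenspace_neg_one hsymm hJ hy,
    Module.End.mem_eigenspace_iff.1 hx]
  simp only [neg_one_smul, inner_add_left, inner_add_right, inner_neg_left,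
    real_inner_self_eq_norm_sq, real_inner_comm x y, hxy]
  ring

theorem morseIndex_eq_finrank_eigenspace_neg_one [FiniteDimensional ℝ Y] {H : Type*}
    [NormedAddCommGroup H] [NormedSpace ℝ H] {f : H → ℝ} {x : H} {l : H →ₗ[ℝ] Y}
    (hl : Function.Surjective l) (hJ : J * J = 1) {c : ℝ} (hc : 0 < c)
    (hf : ∀ v, fderiv ℝ (fderiv ℝ f) x v v = c * inner ℝ (J (l v)) (l v)) :
    morseIndex f x = Module.finrank ℝ (Module.End.eigenspace J (-1)) := by
  apply le_antisymm
  · refine iSup_le fun W => iSup_le fun _ => iSup_le fun hneg => Nat.cast_le.2 ?_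
    let p : W →ₗ[ℝ] Module.End.eigenspace J (-1) := LinearMap.codRestrict _
      ((LinearMap.id - J) ∘ₗ l ∘ₗ W.subtype) fun v => sub_apply_mem_eigenspace_neg_one hJ (l v)
    refine LinearMap.finrank_le_finrank_of_injective (f := p)
      (LinearMap.ker_eq_bot.1 (LinearMap.ker_eq_bot'.2 fun v hv => ?_))
    have hfixed : l v = J (l v) := sub_eq_zero.1 (congrArg Subtype.val hv)
    by_contra hne
    have := hneg v v.2 fun h => hne (Subtype.ext h)
    rw [hf, ← hfixed] at this
    exact this.not_ge (mul_nonneg hc.le real_inner_self_nonneg)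
  · obtain ⟨s, hs⟩ := l.exists_rightInverse_of_surjective (LinearMap.range_eq_top.2 hl)
    have hls : ∀ y, l (s y) = y := fun y => LinearMap.congr_fun hs y
    have hinj : Function.Injective s := Function.LeftInverse.injective hls
    rw [(Submodule.equivMapOfInjective s hinj (Module.End.eigenspace J (-1))).finrank_eq]
    refine le_iSup_of_le ((Module.End.eigenspace J (-1)).map s)
      (le_iSup_of_le inferInstance (le_iSup_of_le ?_ le_rfl))
    rintro _ ⟨y, hy, rfl⟩ hne
    have hy0 : y ≠ 0 := fun h => hne (by rw [h, map_zero])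
    rw [hf, hls, Module.End.mem_eigenspace_iff.1 hy, neg_one_smul, inner_neg_left]
    exact mul_neg_of_pos_of_neg hc (neg_lt_zero.2 (real_inner_self_pos.2 hy0))

end Involution

section ConstantRank

variable {H M Y K : Type*} [NormedAddCommGroup H] [NormedSpace ℝ H] [NormedAddCommGroup Y]
  [NormedSpace ℝ Y] [NormedAddCommGroup K] [NormedSpace ℝ K]

theorem contDiffOn_openPartialHomeomorph_trans {e : OpenPartialHomeomorph H Y}
    {e' : OpenPartialHomeomorph Y K} (he : ContDiffOn ℝ ∞ e e.source)
    (he' : ContDiffOn ℝ ∞ e' e'.source) : ContDiffOn ℝ ∞ (e.trans e') (e.trans e').source := by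
  rw [e.trans_source]
  exact he'.comp_inter he

/-- The constant-rank normal form of `g` near `x`: a smooth chart centred at `x` with values in
`Y × K` whose slices `{y} × K` are the level sets of `g`. The image of the chart is required to
contain every slice that it meets, so that these level sets are connected. -/
structure IsFlatteningChart (g : H → M) (x : H) (e : OpenPartialHomeomorph H (Y × K)) : Prop where
  mem_source : x ∈ e.source
  map_self : e x = (0, 0)
  contDiffOn : ContDiffOn ℝ ∞ e e.source
  contDiffOn_symm : ContDiffOn ℝ ∞ e.symm e.target
  mk_mem_target : ∀ {y k} (k'), (y, k) ∈ e.target → (y, k') ∈ e.target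
  apply_eq_iff : ∀ {u v}, u ∈ e.source → v ∈ e.source → (g u = g v ↔ (e u).1 = (e v).1)

namespace IsFlatteningChart

variable {g : H → M} {x : H} {e : OpenPartialHomeomorph H (Y × K)}

theorem symm_zero (he : IsFlatteningChart g x e) : e.symm (0, 0) = x := by
  rw [← he.map_self, e.left_inv he.mem_source]

theorem zero_mk_mem_target (he : IsFlatteningChart g x e) (k : K) : (0, k) ∈ e.target :=
  he.mk_mem_target (k := 0) k (he.map_self ▸ e.map_source he.mem_source)

theorem image_connectedComponentIn (he : IsFlatteningChart g x e) :
    e '' (e.source ∩ connectedComponentIn {u | g u = g x} x) = {0} ×ˢ Set.univ := by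
  have hx : (e x).1 = 0 := by rw [he.map_self]
  refine Set.Subset.antisymm ?_ ?_
  · rintro _ ⟨u, ⟨hu, huC⟩, rfl⟩
    have hgu : u ∈ {u | g u = g x} := connectedComponentIn_subset _ _ huC
    exact ⟨((he.apply_eq_iff hu he.mem_source).1 hgu).trans hx, Set.mem_univ _⟩
  · rintro ⟨y, k⟩ ⟨rfl, -⟩
    have hcont : Continuous fun k => e.symm ((0 : Y), k) :=
      e.continuousOn_symm.comp_continuous (by fun_prop) he.zero_mk_mem_target
    have hsub : Set.range (fun k => e.symm ((0 : Y), k)) ⊆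
        connectedComponentIn {u | g u = g x} x := by
      refine (isPreconnected_range hcont).subset_connectedComponentIn ⟨0, he.symm_zero⟩ ?_
      rintro _ ⟨k, rfl⟩
      have hk := he.zero_mk_mem_target k
      exact (he.apply_eq_iff (e.map_target hk) he.mem_source).2 (by rw [e.right_inv hk, hx])
    have hk := he.zero_mk_mem_target k
    exact ⟨e.symm (0, k), ⟨e.map_target hk, hsub ⟨k, rfl⟩⟩, e.right_inv hk⟩

theorem trans_prod_refl (he : IsFlatteningChart g x e) {Z : Type*} [NormedAddCommGroup Z]
    [NormedSpace ℝ Z] {m : OpenPartialHomeomorph Y Z} (h0 : 0 ∈ m.source) (hm0 : m 0 = 0)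
    (hm : ContDiffOn ℝ ∞ m m.source) (hm' : ContDiffOn ℝ ∞ m.symm m.target) :
    IsFlatteningChart g x (e.trans (m.prod (.refl K))) := by
  have hsource : ∀ {u}, u ∈ (e.trans (m.prod (.refl K))).source →
      u ∈ e.source ∧ (e u).1 ∈ m.source := fun hu => by simpa using hu
  have htarget : ∀ p, p ∈ (e.trans (m.prod (.refl K))).target ↔
      p.1 ∈ m.target ∧ (m.symm p.1, p.2) ∈ e.target := fun p => by simp
  refine ⟨?_, ?_, ?_, ?_, fun {y k} k' h => ?_, fun {u v} hu hv => ?_⟩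
  · simpa [he.map_self, h0] using he.mem_source
  · simp [he.map_self, hm0]
  · exact contDiffOn_openPartialHomeomorph_trans he.contDiffOn (hm.prodMap contDiffOn_id)
  · exact contDiffOn_openPartialHomeomorph_trans (e := (m.prod (.refl K)).symm) (e' := e.symm)
      (hm'.prodMap contDiffOn_id) he.contDiffOn_symm
  · rw [htarget] at h ⊢
    exact ⟨h.1, he.mk_mem_target k' h.2⟩
  · rw [he.apply_eq_iff (hsource hu).1 (hsource hv).1]
    exact (m.injOn.eq_iff (hsource hu).2 (hsource hv).2).symm

end IsFlatteningChart

variable [NormedAddCommGroup M] [NormedSpace ℝ M]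

theorem eq_zero_of_finrank_range_le {T : H →ₗ[ℝ] M} {L : M →ₗ[ℝ] Y} [FiniteDimensional ℝ T.range]
    (hLT : Function.Surjective (L ∘ₗ T))
    (hrank : Module.finrank ℝ T.range ≤ Module.finrank ℝ Y) {v : H} (hv : L (T v) = 0) :
    T v = 0 := by
  have hsurj : Function.Surjective (L.domRestrict T.range) := fun y =>
    (hLT y).imp' (fun v => ⟨T v, v, rfl⟩) fun _ h => h
  have := Module.Finite.of_surjective _ hsurj
  have hinj := (OrzechProperty.bijective_of_surjective_of_finrank_le _ hsurj hrank).injective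
  exact congrArg Subtype.val (@hinj ⟨T v, v, rfl⟩ 0 (by rw [map_zero]; exact hv))

theorem apply_mk_eq_of_finrank_range_fderiv_le [FiniteDimensional ℝ M] {G : Y × K → M}
    {L : M →L[ℝ] Y} {m₀ : M} {s : Set (Y × K)} (hs : IsOpen s) (hG : DifferentiableOn ℝ G s)
    (hLG : ∀ p ∈ s, L (G p - m₀) = p.1)
    (hrank : ∀ p ∈ s, Module.finrank ℝ (fderiv ℝ G p).range ≤ Module.finrank ℝ Y)
    {y : Y} {B : Set K} (hB : IsOpen B) (hB' : IsPreconnected B) (hsB : ∀ k ∈ B, (y, k) ∈ s)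
    {k k' : K} (hk : k ∈ B) (hk' : k' ∈ B) : G (y, k) = G (y, k') := by
  have hG' : ∀ p ∈ s, HasFDerivAt G (fderiv ℝ G p) p := fun p hp =>
    (hG.differentiableAt (hs.mem_nhds hp)).hasFDerivAt
  have hL : ∀ p ∈ s, ∀ v, L (fderiv ℝ G p v) = v.1 := fun p hp v => by
    have hfst : HasFDerivAt (fun p => L (G p - m₀)) (ContinuousLinearMap.fst ℝ Y K) p :=
      hasFDerivAt_fst.congr_of_eventuallyEq (Filter.eventually_of_mem (hs.mem_nhds hp) hLG)
    exact DFunLike.congr_fun ((L.hasFDerivAt.comp p ((hG' p hp).sub_const m₀)).unique hfst) v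
  have hsnd : ∀ p ∈ s, ∀ κ, fderiv ℝ G p (0, κ) = 0 := fun p hp κ =>
    eq_zero_of_finrank_range_le (T := (fderiv ℝ G p).toLinearMap) (L := L.toLinearMap)
      (fun y => ⟨(y, 0), hL p hp _⟩) (hrank p hp) (hL p hp _)
  have hline : ∀ k ∈ B, HasFDerivAt (fun k => G (y, k)) (0 : K →L[ℝ] M) k := fun k hk =>
    ((hG' _ (hsB k hk)).comp k (hasFDerivAt_prodMk_right y k)).congr_fderiv
      (ContinuousLinearMap.ext (hsnd _ (hsB k hk)))
  exact hB.is_const_of_fderiv_eq_zero hB'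
    (fun k hk => (hline k hk).differentiableAt.differentiableWithinAt)
    (fun k hk => (hline k hk).fderiv) hk hk'

end ConstantRank

section FlatteningChart

variable {H M Y K : Type*} [NormedAddCommGroup H] [InnerProductSpace ℝ H] [NormedAddCommGroup M]
  [NormedSpace ℝ M] [NormedAddCommGroup Y] [NormedSpace ℝ Y] [NormedAddCommGroup K]
  [InnerProductSpace ℝ K]

theorem exists_chart_fst_eq_sub [CompleteSpace H] [CompleteSpace Y] {p : H → Y}
    (hp : ContDiff ℝ ∞ p) {l : H →L[ℝ] Y} (hl : Function.Surjective l) {x : H}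
    (hpl : HasFDerivAt p l x) :
    ∃ e : OpenPartialHomeomorph H (Y × l.ker), x ∈ e.source ∧ e x = (0, 0) ∧
      ContDiffOn ℝ ∞ e e.source ∧ ContDiffOn ℝ ∞ e.symm e.target ∧
      ∀ u, (e u).1 = p u - p x := by
  let P : H →L[ℝ] l.ker := l.ker.orthogonalProjectionOnto
  have hcompl : IsCompl l.ker P.ker := by
    rw [Submodule.ker_orthogonalProjectionOnto]
    exact l.ker.isCompl_orthogonal
  have hderiv : HasFDerivAt (fun u => (p u - p x, P (u - x)))
      (l.equivProdOfSurjectiveOfIsCompl P (LinearMap.range_eq_top.2 hl)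
        (LinearMap.range_eq_top.2 fun k =>
          ⟨k, l.ker.orthogonalProjectionOnto_mem_subspace_eq_self k⟩) hcompl :
        H →L[ℝ] Y × l.ker) x :=
    (hpl.sub_const _).prodMk (P.hasFDerivAt.comp x ((hasFDerivAt_id x).sub_const x))
  obtain ⟨e, hxe, -, he, hsmooth, hsmooth'⟩ := exists_openPartialHomeomorph_contDiffOn_symm
    isOpen_univ (Set.mem_univ x) (by fun_prop) hderiv
  exact ⟨e, hxe, by simp [he], hsmooth, hsmooth', fun u => by rw [he]⟩

theorem exists_chart_target_eq_ball_prod_univ {e : OpenPartialHomeomorph H (Y × K)} {x : H}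
    (hx : x ∈ e.source) (hex : e x = (0, 0)) (he : ContDiffOn ℝ ∞ e e.source)
    (he' : ContDiffOn ℝ ∞ e.symm e.target) :
    ∃ (e' : OpenPartialHomeomorph H (Y × K)) (r : ℝ), x ∈ e'.source ∧ e' x = (0, 0) ∧
      ContDiffOn ℝ ∞ e' e'.source ∧ ContDiffOn ℝ ∞ e'.symm e'.target ∧
      e'.target = Metric.ball 0 r ×ˢ Set.univ ∧ ∀ u, (e' u).1 = (e u).1 := by
  obtain ⟨r, hr, hball⟩ := Metric.isOpen_iff.1 e.open_target (0, 0) (hex ▸ e.map_source hx)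
  rw [← ball_prod_same] at hball
  let b := (OpenPartialHomeomorph.univBall (0 : K) r).symm
  have hb_source : b.source = Metric.ball 0 r := OpenPartialHomeomorph.univBall_target 0 hr
  have hb_target : b.target = Set.univ := OpenPartialHomeomorph.univBall_source 0 r
  let c : OpenPartialHomeomorph (Y × K) (Y × K) :=
    (OpenPartialHomeomorph.ofSet (Metric.ball 0 r) Metric.isOpen_ball).prod b
  have hc_source : c.source ⊆ e.target := (Set.prod_mono subset_rfl hb_source.le).trans hball
  have hc : ContDiffOn ℝ ∞ c c.source := contDiffOn_id.prodMap
    (hb_source ▸ OpenPartialHomeomorph.contDiffOn_univBall_symm)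
  have hc' : ContDiffOn ℝ ∞ c.symm c.target :=
    contDiffOn_id.prodMap OpenPartialHomeomorph.contDiff_univBall.contDiffOn
  refine ⟨e.trans c, r, ?_, ?_, contDiffOn_openPartialHomeomorph_trans he hc,
    contDiffOn_openPartialHomeomorph_trans (e := c.symm) (e' := e.symm) hc' he', ?_, fun u => rfl⟩
  · simp [c, hx, hex, hb_source, hr]
  · simp [c, hex, b]
  · have hc_target : c.target ⊆ c.symm ⁻¹' e.target := fun q hq => hc_source (c.map_target hq)
    rw [e.trans_target, Set.inter_eq_left.2 hc_target]
    exact congrArg (Metric.ball 0 r ×ˢ ·) hb_target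

theorem exists_isFlatteningChart [CompleteSpace H] [FiniteDimensional ℝ M] [CompleteSpace Y]
    {g : H → M} (hg : ContDiff ℝ ∞ g)
    (hrank : ∀ u, Module.finrank ℝ (fderiv ℝ g u).range ≤ Module.finrank ℝ Y) {L : M →L[ℝ] Y}
    {x : H} (hL : Function.Surjective (L ∘L fderiv ℝ g x)) :
    ∃ e : OpenPartialHomeomorph H (Y × (L ∘L fderiv ℝ g x).ker),
      IsFlatteningChart g x e ∧ ∀ u, (e u).1 = L (g u - g x) := by
  have hgd : Differentiable ℝ g := hg.differentiable (by simp)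
  obtain ⟨e₀, hx₀, he₀x, he₀, he₀', hfst₀⟩ := exists_chart_fst_eq_sub (L.contDiff.comp hg) hL
    (L.hasFDerivAt.comp x (hgd x).hasFDerivAt)
  obtain ⟨e, r, hx, hex, he, he', htarget, hfst⟩ :=
    exists_chart_target_eq_ball_prod_univ hx₀ he₀x he₀ he₀'
  have hLg : ∀ u, (e u).1 = L (g u - g x) := fun u => by
    rw [hfst, hfst₀, map_sub, Function.comp_apply, Function.comp_apply]
  have hed : ∀ p ∈ e.target, DifferentiableAt ℝ e.symm p := fun p hp =>
    (he'.contDiffAt (e.open_target.mem_nhds hp)).differentiableAt (by simp)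
  have hslice : ∀ {y k} k', (y, k) ∈ e.target → (y, k') ∈ e.target := fun k' h => by
    rw [htarget] at h ⊢
    exact ⟨h.1, Set.mem_univ _⟩
  have hconst : ∀ {y k} k', (y, k) ∈ e.target → g (e.symm (y, k)) = g (e.symm (y, k')) := by
    intro y k k' hk
    refine apply_mk_eq_of_finrank_range_fderiv_le (G := fun p => g (e.symm p)) (L := L)
      (m₀ := g x) e.open_target (fun p hp => ((hgd _).comp p (hed p hp)).differentiableWithinAt)
      (fun p hp => by rw [← hLg, e.right_inv hp]) (fun p hp => ?_) isOpen_univ isPreconnected_univ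
      (fun k' _ => hslice k' hk) (Set.mem_univ _) (Set.mem_univ _)
    rw [fderiv_fun_comp p (hgd _) (hed p hp)]
    exact (Submodule.finrank_mono (LinearMap.range_comp_le_range _ _)).trans (hrank _)
  refine ⟨e, ⟨hx, hex, he, he', hslice, fun {u v} hu hv => ⟨fun h => ?_, fun h => ?_⟩⟩, hLg⟩
  · rw [hLg, hLg, h]
  · calc g u = g (e.symm ((e u).1, (e u).2)) := by rw [Prod.mk.eta, e.left_inv hu]
      _ = g (e.symm ((e u).1, (e v).2)) := hconst _ (e.map_source hu)
      _ = g v := by rw [h, Prod.mk.eta, e.left_inv hv]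

end FlatteningChart

section MorseChart

variable {H Y Z : Type*} [NormedAddCommGroup H] [NormedSpace ℝ H] [NormedAddCommGroup Z]
  [NormedSpace ℝ Z]

theorem fderiv_fderiv_comp_of_fderiv_eq_zero [NormedAddCommGroup Y] [NormedSpace ℝ Y] {F : Y → Z}
    {p : H → Y} {x : H} (hF : ContDiffAt ℝ 2 F (p x)) (hp : ContDiffAt ℝ 2 p x)
    (hcrit : fderiv ℝ F (p x) = 0) (v w : H) :
    fderiv ℝ (fderiv ℝ fun u => F (p u)) x v w =
      fderiv ℝ (fderiv ℝ F) (p x) (fderiv ℝ p x v) (fderiv ℝ p x w) := by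
  have hderiv : fderiv ℝ (fun u => F (p u)) =ᶠ[nhds x]
      fun u => (fderiv ℝ F (p u)).comp (fderiv ℝ p u) := by
    filter_upwards [hp.continuousAt.eventually (hF.eventually (by simp)), hp.eventually (by simp)]
      with u hFu hpu
    exact fderiv_fun_comp u (hFu.differentiableAt (by simp)) (hpu.differentiableAt (by simp))
  have hF' : DifferentiableAt ℝ (fderiv ℝ F) (p x) :=
    (hF.fderiv_right (m := 1) (by norm_num)).differentiableAt (by simp)
  have hp' : DifferentiableAt ℝ (fderiv ℝ p) x :=
    (hp.fderiv_right (m := 1) (by norm_num)).differentiableAt (by simp)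
  have hFp := hF'.hasFDerivAt.comp x (hp.differentiableAt (by simp)).hasFDerivAt
  have hFp' := hFp.clm_comp hp'.hasFDerivAt
  simp only [Function.comp_apply, hcrit] at hFp'
  rw [hderiv.fderiv_eq, hFp'.fderiv]
  simp

theorem exists_contDiff_eventuallyEq [NormedAddCommGroup Y] [NormedSpace ℝ Y]
    [FiniteDimensional ℝ Y] {f : Y → Z} {s : Set Y} (hs : IsOpen s) (hf : ContDiffOn ℝ ∞ f s)
    {y : Y} (hy : y ∈ s) : ∃ F : Y → Z, ContDiff ℝ ∞ F ∧ F =ᶠ[nhds y] f := by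
  obtain ⟨r, hr, hrs⟩ := Metric.nhds_basis_closedBall.mem_iff.1 (hs.mem_nhds hy)
  let χ : ContDiffBump y := ⟨r / 2, r, by positivity, by linarith⟩
  refine ⟨fun z => χ z • f z, ?_, ?_⟩
  · refine contMDiff_iff_contDiff.1 (contMDiff_of_tsupport fun z hz => ?_)
    have hzs : z ∈ s := hrs (χ.tsupport_eq ▸ tsupport_smul_subset_left _ _ hz)
    exact (χ.contDiffAt.smul (hf.contDiffAt (hs.mem_nhds hzs))).contMDiffAt
  · filter_upwards [χ.eventuallyEq_one] with z hz
    simp [hz]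

variable [NormedAddCommGroup Y] [InnerProductSpace ℝ Y]

theorem hessianOperator_eq_smul_of_fderiv_fderiv_apply_self_eq [CompleteSpace Y] {f : Y → ℝ}
    {x : Y} (hf : ContDiffAt ℝ 2 f x) {J : Y →L[ℝ] Y} (hJ : J.IsSymmetric) {c : ℝ}
    (h : ∀ y, fderiv ℝ (fderiv ℝ f) x y y = c * inner ℝ (J y) y) :
    hessianOperator f x = c • J := by
  have hA : (hessianOperator f x : Y →ₗ[ℝ] Y).IsSymmetric :=
    ContinuousLinearMap.isSelfAdjoint_iff_isSymmetric.1 (star_hessianOperator hf)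
  have hzero := ((hA.sub (hJ.smul (conj_trivial c))).inner_map_self_eq_zero).1 fun y => by
    simp [inner_sub_left, inner_smul_left, inner_hessianOperator, h]
  exact ContinuousLinearMap.coe_injective (sub_eq_zero.1 hzero)

theorem exists_morse_chart_of_involution [FiniteDimensional ℝ Y] {f : Y → ℝ} {s : Set Y}
    (hs : IsOpen s) (h0 : 0 ∈ s) (hf : ContDiffOn ℝ ∞ f s) (hcrit : fderiv ℝ f 0 = 0)
    {J : Module.End ℝ Y} (hsymm : J.IsSymmetric) (hJ : J * J = 1)
    (hfJ : ∀ y, fderiv ℝ (fderiv ℝ f) 0 y y = 2 * inner ℝ (J y) y) :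
    ∃ m : OpenPartialHomeomorph Y Y, 0 ∈ m.source ∧ m.source ⊆ s ∧ m 0 = 0 ∧
      ContDiffOn ℝ ∞ m m.source ∧ ContDiffOn ℝ ∞ m.symm m.target ∧
      ∀ y ∈ m.source, f y = f 0 + inner ℝ (J (m y)) (m y) := by
  obtain ⟨F, hF, hFf⟩ := exists_contDiff_eventuallyEq hs hf h0
  let J' : Y →L[ℝ] Y := Module.End.toContinuousLinearMap Y J
  have hJ' : J' * J' = 1 := by rw [← map_mul, hJ, map_one]
  have hA : hessianOperator F 0 = (2 : ℝ) • J' := by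
    refine hessianOperator_eq_smul_of_fderiv_fderiv_apply_self_eq
      (contDiff_infty.1 hF 2).contDiffAt hsymm fun y => ?_
    rw [hFf.fderiv.fderiv_eq]
    exact hfJ y
  have hunit : IsUnit (hessianOperator F 0) := by
    have hJ_unit : IsUnit J' := ⟨⟨J', J', hJ', hJ'⟩, rfl⟩
    rw [hA]
    exact hJ_unit.smul (Units.mk0 (2 : ℝ) two_ne_zero)
  obtain ⟨m, hm0, hm00, hm, hm', hFm⟩ :=
    exists_morsePalais_chart hF (hFf.fderiv_eq.trans hcrit) hunit
  obtain ⟨t, htf, ht, ht0⟩ := eventually_nhds_iff.1 hFf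
  have hst := hs.inter ht
  refine ⟨m.restrOpen (s ∩ t) hst, ⟨hm0, h0, ht0⟩, fun y hy => hy.2.1, hm00,
    hm.mono Set.inter_subset_left, hm'.mono Set.inter_subset_left, fun y hy => ?_⟩
  rw [← htf y hy.2.2, ← htf 0 ht0, hFm y hy.1, hA, smul_apply,
    real_inner_smul_left, inv_mul_cancel_left₀ two_ne_zero]
  rfl

end MorseChart

section MorseBott

variable {H M Y : Type*}

theorem IsFlatteningChart.exists_contDiffOn_eq_comp_fst [NormedAddCommGroup H] [NormedSpace ℝ H]
    [NormedAddCommGroup Y] [NormedSpace ℝ Y] {K Z : Type*} [NormedAddCommGroup K] [NormedSpace ℝ K]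
    [NormedAddCommGroup Z] [NormedSpace ℝ Z] {g : H → M} {x : H}
    {e : OpenPartialHomeomorph H (Y × K)} (he : IsFlatteningChart g x e) {f : H → Z}
    (hf : ContDiff ℝ ∞ f) (hfg : f.FactorsThrough g) :
    ∃ (F : Y → Z) (s : Set Y), IsOpen s ∧ 0 ∈ s ∧ ContDiffOn ℝ ∞ F s ∧
      ∀ u ∈ e.source, f u = F (e u).1 := by
  refine ⟨fun y => f (e.symm (y, 0)), {y | (y, 0) ∈ e.target},
    e.open_target.preimage (by fun_prop), he.zero_mk_mem_target 0,
    hf.comp_contDiffOn (he.contDiffOn_symm.comp (by fun_prop) fun y hy => hy), fun u hu => ?_⟩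
  have hmem : ((e u).1, 0) ∈ e.target := he.mk_mem_target (k := (e u).2) 0 (e.map_source hu)
  exact hfg ((he.apply_eq_iff hu (e.map_target hmem)).2 (by rw [e.right_inv hmem]))

variable [NormedAddCommGroup H] [InnerProductSpace ℝ H] [CompleteSpace H]
  [NormedAddCommGroup Y] [InnerProductSpace ℝ Y] [FiniteDimensional ℝ Y]

theorem exists_isFlatteningChart_eq_add_inner [NormedAddCommGroup M] [NormedSpace ℝ M]
    [FiniteDimensional ℝ M] {f : H → ℝ} {g : H → M}
    (hf : ContDiff ℝ ∞ f) (hg : ContDiff ℝ ∞ g) (hfg : f.FactorsThrough g)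
    (hrank : ∀ u, Module.finrank ℝ (fderiv ℝ g u).range ≤ Module.finrank ℝ Y) {L : M →L[ℝ] Y}
    {x : H} (hL : Function.Surjective (L ∘L fderiv ℝ g x)) (hcrit : fderiv ℝ f x = 0)
    {J : Module.End ℝ Y} (hsymm : J.IsSymmetric) (hJ : J * J = 1)
    (hfJ : ∀ v, fderiv ℝ (fderiv ℝ f) x v v =
      2 * inner ℝ (J (L (fderiv ℝ g x v))) (L (fderiv ℝ g x v))) :
    ∃ e : OpenPartialHomeomorph H (Y × (L ∘L fderiv ℝ g x).ker),
      IsFlatteningChart g x e ∧ ∀ u ∈ e.source, f u = f x + inner ℝ (J (e u).1) (e u).1 := by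
  obtain ⟨e, he, hfst⟩ := exists_isFlatteningChart hg hrank hL
  obtain ⟨F, s, hs, h0, hF, hfF⟩ := he.exists_contDiffOn_eq_comp_fst hf hfg
  let p : H → Y := fun u => L (g u - g x)
  have hp : ContDiff ℝ ∞ p := L.contDiff.comp (hg.sub contDiff_const)
  have hpx : p x = 0 := by simp [p]
  have hp' : HasFDerivAt p (L ∘L fderiv ℝ g x) x :=
    L.hasFDerivAt.comp x ((hg.differentiable (by simp) x).hasFDerivAt.sub_const _)
  have hfFp : f =ᶠ[nhds x] fun u => F (p u) :=
    Filter.eventually_of_mem (e.open_source.mem_nhds he.mem_source) fun u hu => by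
      rw [hfF u hu, hfst]
  have hF_at : ContDiffAt ℝ ∞ F (p x) := hpx ▸ hF.contDiffAt (hs.mem_nhds h0)
  have hF_crit : fderiv ℝ F (p x) = 0 := by
    have hcomp := ((hF_at.differentiableAt (by simp)).hasFDerivAt.comp x hp').congr_of_eventuallyEq
      hfFp
    refine ContinuousLinearMap.ext fun y => ?_
    obtain ⟨v, rfl⟩ := hL y
    exact DFunLike.congr_fun (hcomp.fderiv.symm.trans hcrit) v
  have hFJ : ∀ y, fderiv ℝ (fderiv ℝ F) 0 y y = 2 * inner ℝ (J y) y := fun y => by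
    obtain ⟨v, rfl⟩ := hL y
    rw [← hpx, ← hp'.fderiv, ← fderiv_fderiv_comp_of_fderiv_eq_zero (contDiffAt_infty.1 hF_at 2)
      (contDiff_infty.1 hp 2).contDiffAt hF_crit, ← hfFp.fderiv.fderiv_eq, hfJ, hp'.fderiv]
    rfl
  obtain ⟨m, hm0, -, hm00, hm, hm', hFm⟩ :=
    exists_morse_chart_of_involution hs h0 hF (hpx ▸ hF_crit) hsymm hJ hFJ
  refine ⟨_, he.trans_prod_refl hm0 hm00 hm hm', fun u hu => ?_⟩
  have hum : (e u).1 ∈ m.source := hu.2.1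
  rw [hfF u hu.1, hFm _ hum, hfF x he.mem_source, he.map_self]
  rfl

theorem exists_linearIsometry_range_eq_orthogonal_ker {l : H →L[ℝ] Y}
    (hl : Function.Surjective l) : ∃ j : Y →ₗᵢ[ℝ] H, j.range = l.kerᗮ := by
  have e : l.kerᗮ ≃ₗ[ℝ] Y :=
    (Submodule.quotientEquivOfIsCompl _ _ l.ker.isCompl_orthogonal).symm.trans
      (l.toLinearMap.quotKerEquivOfSurjective hl)
  have : FiniteDimensional ℝ l.kerᗮ := e.symm.finiteDimensional
  let ι : Y ≃ₗᵢ[ℝ] l.kerᗮ :=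
    (stdOrthonormalBasis ℝ Y).equiv (stdOrthonormalBasis ℝ l.kerᗮ) (finCongr e.finrank_eq.symm)
  refine ⟨l.kerᗮ.subtypeₗᵢ.comp ι.toLinearIsometry, ?_⟩
  change (l.kerᗮ.subtype ∘ₗ ι.toLinearEquiv.toLinearMap).range = _
  rw [LinearMap.range_comp, LinearEquiv.range, Submodule.map_top, Submodule.range_subtype]

theorem exists_continuousLinearEquiv_prod_of_range_eq_orthogonal {K : Submodule ℝ H}
    [CompleteSpace K] {j : Y →ₗᵢ[ℝ] H} (hj : j.range = Kᗮ) :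
    ∃ Λ : (Y × K) ≃L[ℝ] H, ∀ y k, Λ (y, k) = j y + k := by
  have hcompl : IsCompl j.range K := hj ▸ K.isCompl_orthogonal.symm
  refine ⟨ContinuousLinearEquiv.ofBijective
    (j.toContinuousLinearMap.coprod K.subtypeL) ?_ ?_, fun y k => rfl⟩
  · exact (LinearMap.ker_coprod_of_disjoint_range _ _ (by simpa using hcompl.disjoint)).trans
      (by simp [LinearMap.ker_eq_bot.2 j.injective])
  · exact (LinearMap.range_coprod _ _).trans (by simpa using hcompl.sup_eq_top)

/-- Morse–Bott normal form of `f` at `x`, of index `p` and coindex `q`, along the set `C`: a smooth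
chart, with values in the orthogonal sum of `P₁`, `P₂` and `K`, maps `C` onto `K` and turns `f` into
`f x - ‖v₁‖ ^ 2 + ‖v₂‖ ^ 2`. -/
def HasMorseBottChart (f : H → ℝ) (C : Set H) (x : H) (p q : ℕ) : Prop :=
  ∃ (P₁ P₂ K : Submodule ℝ H) (φ : OpenPartialHomeomorph H H),
    P₁ ⟂ P₂ ∧ P₁ ⟂ K ∧ P₂ ⟂ K ∧ P₁ ⊔ P₂ ⊔ K = ⊤ ∧
    FiniteDimensional ℝ P₁ ∧ Module.finrank ℝ P₁ = p ∧
    FiniteDimensional ℝ P₂ ∧ Module.finrank ℝ P₂ = q ∧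
    x ∈ φ.source ∧ ContDiffOn ℝ ∞ φ φ.source ∧ ContDiffOn ℝ ∞ φ.symm φ.target ∧
    φ x = 0 ∧ φ '' (φ.source ∩ C) = (K : Set H) ∧
    ∀ v₁ ∈ P₁, ∀ v₂ ∈ P₂, ∀ w ∈ K, v₁ + v₂ + w ∈ φ.target →
      f (φ.symm (v₁ + v₂ + w)) = f x - ‖v₁‖ ^ 2 + ‖v₂‖ ^ 2

theorem IsFlatteningChart.hasMorseBottChart {f : H → ℝ} {g : H → M} {x : H} {K : Submodule ℝ H}
    [CompleteSpace K] {e : OpenPartialHomeomorph H (Y × K)} (he : IsFlatteningChart g x e)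
    {J : Module.End ℝ Y} (hsymm : J.IsSymmetric) (hJ : J * J = 1)
    (hf : ∀ u ∈ e.source, f u = f x + inner ℝ (J (e u).1) (e u).1)
    {j : Y →ₗᵢ[ℝ] H} (hj : j.range = Kᗮ) :
    HasMorseBottChart f (connectedComponentIn {u | g u = g x} x) x
      (Module.finrank ℝ (Module.End.eigenspace J (-1)))
      (Module.finrank ℝ Y - Module.finrank ℝ (Module.End.eigenspace J (-1))) := by
  obtain ⟨Λ, hΛ⟩ := exists_continuousLinearEquiv_prod_of_range_eq_orthogonal hj
  let E := Module.End.eigenspace J (-1)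
  have hjK (V : Submodule ℝ Y) : V.map j.toLinearMap ⟂ K :=
    (Submodule.isOrtho_orthogonal_left K).mono_left (hj ▸ LinearMap.map_le_range)
  refine ⟨E.map j.toLinearMap, Eᗮ.map j.toLinearMap, K, e.transHomeomorph Λ.toHomeomorph,
    (Submodule.isOrtho_orthogonal_right E).map j, hjK E, hjK Eᗮ, ?_, inferInstance,
    (E.equivMapOfInjective _ j.injective).finrank_eq.symm, inferInstance, ?_, he.mem_source,
    Λ.contDiff.comp_contDiffOn he.contDiffOn,
    he.contDiffOn_symm.comp Λ.symm.contDiff.contDiffOn fun _ h => h, ?_, ?_, ?_⟩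
  · rw [← Submodule.map_sup, Submodule.sup_orthogonal_of_hasOrthogonalProjection,
      Submodule.map_top]
    exact hj ▸ K.isCompl_orthogonal.symm.sup_eq_top
  · rw [← (Eᗮ.equivMapOfInjective _ j.injective).finrank_eq,
      ← E.finrank_add_finrank_orthogonal, Nat.add_sub_cancel_left]
  · exact (congrArg Λ he.map_self).trans Λ.map_zero
  · change (Λ ∘ e) '' _ = _
    rw [Set.image_comp, e.transHomeomorph_source, he.image_connectedComponentIn]
    ext z
    simp [Set.mem_prod, hΛ]
  · rintro _ ⟨y₁, hy₁, rfl⟩ _ ⟨y₂, hy₂, rfl⟩ w hw hmem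
    have hsymm_apply : Λ.symm (j y₁ + j y₂ + w) = (y₁ + y₂, ⟨w, hw⟩) := by
      rw [Λ.symm_apply_eq, hΛ, map_add]
    have hmem' : (y₁ + y₂, (⟨w, hw⟩ : K)) ∈ e.target := hsymm_apply ▸ hmem
    change f (e.symm (Λ.symm (j y₁ + j y₂ + w))) = f x - ‖j y₁‖ ^ 2 + ‖j y₂‖ ^ 2
    rw [hsymm_apply, hf _ (e.map_target hmem'), e.right_inv hmem',
      inner_apply_add_self_of_mem_eigenspace_neg_one hsymm hJ hy₁ hy₂, j.norm_map, j.norm_map]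
    ring

theorem hasMorseBottChart_of_involution [NormedAddCommGroup M] [NormedSpace ℝ M]
    [FiniteDimensional ℝ M] {f : H → ℝ} {g : H → M}
    (hf : ContDiff ℝ ∞ f) (hg : ContDiff ℝ ∞ g) (hfg : f.FactorsThrough g)
    (hrank : ∀ u, Module.finrank ℝ (fderiv ℝ g u).range ≤ Module.finrank ℝ Y) {L : M →L[ℝ] Y}
    {x : H} (hL : Function.Surjective (L ∘L fderiv ℝ g x)) (hcrit : fderiv ℝ f x = 0)
    {J : Module.End ℝ Y} (hsymm : J.IsSymmetric) (hJ : J * J = 1)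
    (hfJ : ∀ v, fderiv ℝ (fderiv ℝ f) x v v =
      2 * inner ℝ (J (L (fderiv ℝ g x v))) (L (fderiv ℝ g x v))) :
    HasMorseBottChart f (connectedComponentIn {u | g u = g x} x) x
      (Module.finrank ℝ (Module.End.eigenspace J (-1)))
      (Module.finrank ℝ Y - Module.finrank ℝ (Module.End.eigenspace J (-1))) := by
  obtain ⟨e, he, hfe⟩ :=
    exists_isFlatteningChart_eq_add_inner hf hg hfg hrank hL hcrit hsymm hJ hfJ
  obtain ⟨j, hj⟩ := exists_linearIsometry_range_eq_orthogonal_ker hL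
  exact he.hasMorseBottChart hsymm hJ hfe hj

end MorseBott

section Landscape

lemma exists_involution_traceCLM_lie_lie {n : ℕ} {θ ρ : Matrix (Fin n) (Fin n) ℂ}
    (hρ : ρ.IsHermitian) (hθ : θ.IsHermitian) (hsimple : Function.Injective hθ.eigenvalues)
    (hcomm : Commute θ ρ) :
    ∃ (J : Module.End ℝ (EuclideanSpace ℝ (Fin (Module.finrank ℝ (tangentSpace ρ)))))
      (τ : tangentSpace ρ ≃ₗ[ℝ] EuclideanSpace ℝ (Fin (Module.finrank ℝ (tangentSpace ρ)))),
      J.IsSymmetric ∧ J * J = 1 ∧ ∀ (A : Matrix (Fin n) (Fin n) ℂ) (hA : Aᴴ = -A),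
        traceCLM θ ⁅A, ⁅A, ρ⁆⁆ = 2 * inner ℝ (J (τ ⟨_, lie_mem_tangentSpace hA ρ⟩))
          (τ ⟨_, lie_mem_tangentSpace hA ρ⟩) := by
  obtain ⟨b, hsymm, hsep, hb⟩ := exists_nondegenerate_hessian hρ hθ hsimple hcomm
  obtain ⟨J, τ, hJsymm, hJ, hbJ⟩ := exists_symmetric_involution_of_separatingLeft
    (b := (2⁻¹ : ℝ) • b) ⟨fun x y => congrArg (2⁻¹ * ·) (hsymm.eq x y)⟩
    fun x hx => hsep x fun y => (mul_eq_zero_iff_left (by norm_num)).1 (hx y)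
  refine ⟨J, τ, hJsymm, hJ, fun A hA => ?_⟩
  rw [← hb A hA, ← hbJ, LinearMap.smul_apply, LinearMap.smul_apply, smul_eq_mul,
    mul_inv_cancel_left₀ two_ne_zero]

lemma fderiv_fderiv_clm_comp_apply {H M Z : Type*} [NormedAddCommGroup H] [NormedSpace ℝ H]
    [NormedAddCommGroup M] [NormedSpace ℝ M] [NormedAddCommGroup Z] [NormedSpace ℝ Z]
    (L : M →L[ℝ] Z) {g : H → M} (hg : ContDiff ℝ 2 g) (u v w : H) :
    fderiv ℝ (fderiv ℝ fun u => L (g u)) u v w = L (fderiv ℝ (fderiv ℝ g) u v w) := by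
  have hd : (fderiv ℝ fun u => L (g u)) = fun u => L ∘L fderiv ℝ g u :=
    funext fun u =>
      (L.hasFDerivAt.comp u (hg.differentiable two_ne_zero u).hasFDerivAt).fderiv
  have hdg := (hg.fderiv_right (m := 1) le_rfl).differentiable one_ne_zero u
  rw [hd]
  exact DFunLike.congr_fun (DFunLike.congr_fun
    ((ContinuousLinearMap.compL ℝ H M Z L).hasFDerivAt.comp u hdg.hasFDerivAt).fderiv v) w

attribute [local instance] Matrix.linftyOpNormedRing Matrix.linftyOpNormedAlgebra

variable {n : ℕ} {T : ℝ} {H₀ H₁ θ : Matrix (Fin n) (Fin n) ℂ}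

-- Mathlib's instance is about the entrywise topology, which instance search does not identify with
-- the topology of the norm.
lemma continuousStar_matrix_linftyOp : @ContinuousStar (Matrix (Fin n) (Fin n) ℂ)
    PseudoMetricSpace.toUniformSpace.toTopologicalSpace _ :=
  ⟨continuous_id.matrix_conjTranspose⟩

attribute [local instance] continuousStar_matrix_linftyOp

lemma contDiff_endPoint (h : 0 ≤ T) (H₀ H₁ ρ₀ : Matrix (Fin n) (Fin n) ℂ) :
    ContDiff ℝ ∞ (endPoint T H₀ H₁ ρ₀) :=
  endPoint_eq_commutatorFlow h H₀ H₁ ρ₀ ▸ contDiff_commutatorFlow h H₀ H₁ ρ₀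

lemma endPoint_eq_conj_propagator (h : 0 ≤ T) (hH₀ : H₀ᴴ = -H₀) (hH₁ : H₁ᴴ = -H₁)
    (ρ₀ : Matrix (Fin n) (Fin n) ℂ) :
    endPoint T H₀ H₁ ρ₀ = fun u => propagator h H₀ H₁ u * ρ₀ * star (propagator h H₀ H₁ u) :=
  (endPoint_eq_commutatorFlow h H₀ H₁ ρ₀).trans
    (funext (commutatorFlow_eq_conj h hH₀ hH₁ ρ₀))

lemma fderiv_endPoint_apply (h : 0 ≤ T) (hH₀ : H₀ᴴ = -H₀) (hH₁ : H₁ᴴ = -H₁)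
    (ρ₀ : Matrix (Fin n) (Fin n) ℂ) (u v : Control T) :
    fderiv ℝ (endPoint T H₀ H₁ ρ₀) u v =
      ⁅maurerCartan (propagator h H₀ H₁) u v, endPoint T H₀ H₁ ρ₀ u⁆ := by
  have hU := propagator_mul_star h hH₀ hH₁
  rw [endPoint_eq_conj_propagator h hH₀ hH₁]
  exact fderiv_conj_apply ((contDiff_propagator h H₀ H₁).differentiable (by simp) u) hU
    (fun u => mul_eq_one_comm.1 (hU u)) ρ₀ v

lemma conjTranspose_maurerCartan_propagator (h : 0 ≤ T) (hH₀ : H₀ᴴ = -H₀) (hH₁ : H₁ᴴ = -H₁)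
    (u v : Control T) :
    (maurerCartan (propagator h H₀ H₁) u v)ᴴ = -maurerCartan (propagator h H₀ H₁) u v :=
  star_maurerCartan ((contDiff_propagator h H₀ H₁).differentiable (by simp) u)
    (propagator_mul_star h hH₀ hH₁) v

lemma range_fderiv_endPoint_le (h : 0 ≤ T) (hH₀ : H₀ᴴ = -H₀) (hH₁ : H₁ᴴ = -H₁)
    (ρ₀ : Matrix (Fin n) (Fin n) ℂ) (u : Control T) :
    (fderiv ℝ (endPoint T H₀ H₁ ρ₀) u).range ≤ tangentSpace (endPoint T H₀ H₁ ρ₀ u) := by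
  rintro _ ⟨v, rfl⟩
  rw [ContinuousLinearMap.coe_coe, fderiv_endPoint_apply h hH₀ hH₁]
  exact lie_mem_tangentSpace (conjTranspose_maurerCartan_propagator h hH₀ hH₁ u v) _

lemma finrank_tangentSpace_endPoint (h : 0 ≤ T) (hH₀ : H₀ᴴ = -H₀) (hH₁ : H₁ᴴ = -H₁)
    (ρ₀ : Matrix (Fin n) (Fin n) ℂ) (u : Control T) :
    Module.finrank ℝ (tangentSpace (endPoint T H₀ H₁ ρ₀ u)) = orbitDim ρ₀ := by
  rw [endPoint_eq_conj_propagator h hH₀ hH₁]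
  exact finrank_tangentSpace_conj ρ₀
    ⟨_, Matrix.mem_unitaryGroup_iff.2 (propagator_mul_star h hH₀ hH₁ u)⟩

lemma IsRegularControl.range_fderiv_endPoint {ρ₀ : Matrix (Fin n) (Fin n) ℂ} {u : Control T}
    (hu : IsRegularControl T H₀ H₁ ρ₀ u) (h : 0 ≤ T) (hH₀ : H₀ᴴ = -H₀) (hH₁ : H₁ᴴ = -H₁) :
    (fderiv ℝ (endPoint T H₀ H₁ ρ₀) u).range = tangentSpace (endPoint T H₀ H₁ ρ₀ u) :=
  Submodule.eq_of_le_of_finrank_eq (range_fderiv_endPoint_le h hH₀ hH₁ ρ₀ u)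
    (hu.trans (finrank_tangentSpace_endPoint h hH₀ hH₁ ρ₀ u).symm)

lemma fderiv_cost_eq_zero (h : 0 ≤ T) (hH₀ : H₀ᴴ = -H₀) (hH₁ : H₁ᴴ = -H₁)
    {ρ₀ : Matrix (Fin n) (Fin n) ℂ} {u : Control T}
    (hcomm : Commute θ (endPoint T H₀ H₁ ρ₀ u)) : fderiv ℝ (cost T H₀ H₁ ρ₀ θ) u = 0 := by
  refine ((traceCLM θ).hasFDerivAt.comp u ((contDiff_endPoint h H₀ H₁ ρ₀).differentiable
    (by simp) u).hasFDerivAt).fderiv.trans (ContinuousLinearMap.ext fun v => ?_)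
  exact (congrArg _ (fderiv_endPoint_apply h hH₀ hH₁ ρ₀ u v)).trans (traceCLM_lie_eq_zero hcomm _)

lemma fderiv_fderiv_cost_apply_self (h : 0 ≤ T) (hH₀ : H₀ᴴ = -H₀) (hH₁ : H₁ᴴ = -H₁)
    {ρ₀ : Matrix (Fin n) (Fin n) ℂ} {u : Control T}
    (hcomm : Commute θ (endPoint T H₀ H₁ ρ₀ u)) (v : Control T) :
    fderiv ℝ (fderiv ℝ (cost T H₀ H₁ ρ₀ θ)) u v v =
      traceCLM θ ⁅maurerCartan (propagator h H₀ H₁) u v,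
        ⁅maurerCartan (propagator h H₀ H₁) u v, endPoint T H₀ H₁ ρ₀ u⁆⁆ := by
  have hU := propagator_mul_star h hH₀ hH₁
  have hU_smooth := contDiff_infty.1 (contDiff_propagator h H₀ H₁) 2
  refine (fderiv_fderiv_clm_comp_apply (traceCLM θ)
    (contDiff_infty.1 (contDiff_endPoint h H₀ H₁ ρ₀) 2) u v v).trans ?_
  rw [endPoint_eq_conj_propagator h hH₀ hH₁] at hcomm ⊢
  rw [fderiv_fderiv_conj_apply hU_smooth hU (fun u => mul_eq_one_comm.1 (hU u))]
  exact ((traceCLM θ).map_add _ _).trans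
    (add_eq_right.2 (traceCLM_lie_eq_zero hcomm _))

theorem morseIndex_cost_eq_and_hasMorseBottChart_cost (h : 0 ≤ T) (hH₀ : H₀ᴴ = -H₀)
    (hH₁ : H₁ᴴ = -H₁) {ρ₀ : Matrix (Fin n) (Fin n) ℂ} {u : Control T}
    (hu : IsRegularControl T H₀ H₁ ρ₀ u) (hcomm : Commute θ (endPoint T H₀ H₁ ρ₀ u))
    {Y : Type*} [NormedAddCommGroup Y] [InnerProductSpace ℝ Y] [FiniteDimensional ℝ Y]
    (τ : tangentSpace (endPoint T H₀ H₁ ρ₀ u) ≃ₗ[ℝ] Y)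
    {J : Module.End ℝ Y} (hsymm : J.IsSymmetric) (hJ : J * J = 1)
    (hτ : ∀ (A : Matrix (Fin n) (Fin n) ℂ) (hA : Aᴴ = -A),
      traceCLM θ ⁅A, ⁅A, endPoint T H₀ H₁ ρ₀ u⁆⁆ =
        2 * inner ℝ (J (τ ⟨_, lie_mem_tangentSpace hA _⟩)) (τ ⟨_, lie_mem_tangentSpace hA _⟩)) :
    morseIndex (cost T H₀ H₁ ρ₀ θ) u = Module.finrank ℝ (Module.End.eigenspace J (-1)) ∧
      HasMorseBottChart (cost T H₀ H₁ ρ₀ θ)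
        (connectedComponentIn (fiber T H₀ H₁ ρ₀ (endPoint T H₀ H₁ ρ₀ u)) u) u
        (Module.finrank ℝ (Module.End.eigenspace J (-1)))
        (orbitDim ρ₀ - Module.finrank ℝ (Module.End.eigenspace J (-1))) := by
  have hdim : Module.finrank ℝ Y = orbitDim ρ₀ :=
    τ.finrank_eq.symm.trans (finrank_tangentSpace_endPoint h hH₀ hH₁ ρ₀ u)
  obtain ⟨L, hL⟩ := LinearMap.exists_extend τ.toLinearMap
  have hLτ (η : tangentSpace (endPoint T H₀ H₁ ρ₀ u)) : L η = τ η := LinearMap.congr_fun hL η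
  have hsurj : Function.Surjective
      (L.toContinuousLinearMap ∘L fderiv ℝ (endPoint T H₀ H₁ ρ₀) u) := fun y => by
    obtain ⟨v, hv⟩ := (hu.range_fderiv_endPoint h hH₀ hH₁).ge (τ.symm y).2
    exact ⟨v, (congrArg L hv).trans ((hLτ _).trans (τ.apply_symm_apply y))⟩
  have hhess (v : Control T) : fderiv ℝ (fderiv ℝ (cost T H₀ H₁ ρ₀ θ)) u v v =
      2 * inner ℝ (J (L (fderiv ℝ (endPoint T H₀ H₁ ρ₀) u v)))
        (L (fderiv ℝ (endPoint T H₀ H₁ ρ₀) u v)) := by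
    rw [fderiv_fderiv_cost_apply_self h hH₀ hH₁ hcomm, fderiv_endPoint_apply h hH₀ hH₁,
      hτ _ (conjTranspose_maurerCartan_propagator h hH₀ hH₁ u v), ← hLτ]
  have hrank (u : Control T) :
      Module.finrank ℝ (fderiv ℝ (endPoint T H₀ H₁ ρ₀) u).range ≤ Module.finrank ℝ Y := by
    rw [hdim, ← finrank_tangentSpace_endPoint h hH₀ hH₁ ρ₀ u]
    exact Submodule.finrank_mono (range_fderiv_endPoint_le h hH₀ hH₁ ρ₀ u)
  exact ⟨morseIndex_eq_finrank_eigenspace_neg_one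
      (l := (L.toContinuousLinearMap ∘L fderiv ℝ (endPoint T H₀ H₁ ρ₀) u).toLinearMap)
      hsurj hJ two_pos hhess,
    hdim ▸ hasMorseBottChart_of_involution
      ((traceCLM θ).contDiff.comp (contDiff_endPoint h H₀ H₁ ρ₀)) (contDiff_endPoint h H₀ H₁ ρ₀)
      (fun _ _ huv => congrArg (traceCLM θ) huv) hrank hsurj
      (fderiv_cost_eq_zero h hH₀ hH₁ hcomm) hsymm hJ hhess⟩

end Landscape

end

end QuantumControl

theorem mainTheorem2_general {n : ℕ} {T : ℝ} (hT : 0 ≤ T) {H₀ H₁ ρ₀ θ : Matrix (Fin n) (Fin n) ℂ}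
    (hH₀ : H₀ᴴ = -H₀) (hH₁ : H₁ᴴ = -H₁) (hρ₀ : ρ₀.IsHermitian) (hθ : θ.IsHermitian)
    (hθ_simple : Function.Injective hθ.eigenvalues) {ρc : Matrix (Fin n) (Fin n) ℂ}
    (hρc : QuantumControl.IsKinematicCritical θ ρ₀ ρc) :
    ∃ N₁ ≤ QuantumControl.orbitDim ρ₀, ∀ uc ∈ QuantumControl.fiber T H₀ H₁ ρ₀ ρc,
      QuantumControl.IsRegularControl T H₀ H₁ ρ₀ uc →
        QuantumControl.morseIndex (QuantumControl.cost T H₀ H₁ ρ₀ θ) uc = (N₁ : ℕ∞) ∧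
        QuantumControl.HasMorseBottChart (QuantumControl.cost T H₀ H₁ ρ₀ θ)
          (connectedComponentIn (QuantumControl.fiber T H₀ H₁ ρ₀ ρc) uc) uc N₁
          (QuantumControl.orbitDim ρ₀ - N₁) := by
  have hcomm := QuantumControl.commute_of_isKinematicCritical hρ₀ hθ hρc
  obtain ⟨J, τ, hsymm, hJ, hτ⟩ := QuantumControl.exists_involution_traceCLM_lie_lie
    (QuantumControl.isHermitian_of_mem_orbit hρ₀ hρc.1) hθ hθ_simple hcomm
  refine ⟨Module.finrank ℝ (Module.End.eigenspace J (-1)),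
    (Submodule.finrank_le _).trans (finrank_euclideanSpace_fin.trans
      (QuantumControl.finrank_tangentSpace_of_mem_orbit hρc.1)).le, ?_⟩
  rintro uc (rfl : QuantumControl.endPoint T H₀ H₁ ρ₀ uc = ρc) huc
  exact QuantumControl.morseIndex_cost_eq_and_hasMorseBottChart_cost hT hH₀ hH₁ huc hcomm τ hsymm
    hJ hτ

theorem mainTheorem2 {n : ℕ} (T : ℝ) (hT : 0 < T)
    (H₀ H₁ ρ₀ θ : Matrix (Fin n) (Fin n) ℂ)
    (hH₀ : H₀ ∈ QuantumControl.su n) (hH₁ : H₁ ∈ QuantumControl.su n)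
    (hρ₀ : ρ₀.IsHermitian) (hθ : θ.IsHermitian)
    (hρ₀_simple : Function.Injective hρ₀.eigenvalues)
    (hθ_simple : Function.Injective hθ.eigenvalues)
    (hreg : ∀ u : QuantumControl.Control T, QuantumControl.IsRegularControl T H₀ H₁ ρ₀ u)
    (ρc : Matrix (Fin n) (Fin n) ℂ) (hρc : QuantumControl.IsKinematicCritical θ ρ₀ ρc) :
    -- `N₁` depends on the critical point `ρc` of `J` only
    ∃ N₁ : ℕ, N₁ ≤ QuantumControl.orbitDim ρ₀ ∧
      ∀ C : Set (QuantumControl.Control T),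
        (∃ x ∈ QuantumControl.fiber T H₀ H₁ ρ₀ ρc,
          C = connectedComponentIn (QuantumControl.fiber T H₀ H₁ ρ₀ ρc) x) →
        ∀ uc ∈ C,
          QuantumControl.morseIndex (QuantumControl.cost T H₀ H₁ ρ₀ θ) uc = (N₁ : ℕ∞) ∧
          ∃ (P₁ P₂ K : Submodule ℝ (QuantumControl.Control T))
            (φ : OpenPartialHomeomorph (QuantumControl.Control T) (QuantumControl.Control T)),
            -- the orthogonal decomposition of the control space
            P₁ ⟂ P₂ ∧ P₁ ⟂ K ∧ P₂ ⟂ K ∧ P₁ ⊔ P₂ ⊔ K = ⊤ ∧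
            -- the dimensions of the two finite-dimensional summands
            FiniteDimensional ℝ P₁ ∧ Module.finrank ℝ P₁ = N₁ ∧
            FiniteDimensional ℝ P₂ ∧ Module.finrank ℝ P₂ = QuantumControl.orbitDim ρ₀ - N₁ ∧
            -- `φ` is a smooth chart around `uc`
            uc ∈ φ.source ∧ ContDiffOn ℝ ∞ φ φ.source ∧ ContDiffOn ℝ ∞ φ.symm φ.target ∧
            -- it straightens the component `C`
            φ uc = 0 ∧ φ '' (φ.source ∩ C) = (K : Set (QuantumControl.Control T)) ∧
            -- the cost in the chart
            ∀ v₁ ∈ P₁, ∀ v₂ ∈ P₂, ∀ w ∈ K, v₁ + v₂ + w ∈ φ.target →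
              QuantumControl.cost T H₀ H₁ ρ₀ θ (φ.symm (v₁ + v₂ + w)) =
                QuantumControl.cost T H₀ H₁ ρ₀ θ uc - ‖v₁‖ ^ 2 + ‖v₂‖ ^ 2 := by
  obtain ⟨N₁, hN₁, hchart⟩ := mainTheorem2_general hT.le hH₀.1 hH₁.1 hρ₀ hθ hθ_simple hρc
  refine ⟨N₁, hN₁, ?_⟩
  rintro C ⟨x, -, rfl⟩ uc huc
  rw [connectedComponentIn_eq huc]
  exact hchart uc (connectedComponentIn_subset _ _ huc) (hreg uc)
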